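/- Let $f(x,y,z,t)=f_t(x,y,z)\in\mathbb{C}\{x,y,z,t\}$, $t\in(\mathbb{C}^l,0)$, be a convergent power series with $f_t(0)=0$ for all small $t$ (not necessarily reduced), and let $V_t=f_t^{-1}(0)\subset(\mathbb{C}^3,0)$ be the corresponding family of surface germs. **Discriminants.** For a monic polynomial of degree $d$ with roots $\xi_1,\dots,\xi_d$ and $i\ge 1$, let $D^i=\sum_{|S|=d-i+1}\ \prod_{k<l,\ k,l\in S}(\xi_k-\xi_l)^2$. If a convergent power series $g$ is regular in its last variable, $D^i_g$ denotes the $i$-th such discriminant of the Weierstrass polynomial of $g$ in that variable, and $\Delta(g)$ denotes the first $D^i_g$, $i\geq 1$, that is not identically zero (for reduced $g$ this is the usual discriminant $D_g$; in general it is a nonzero constant times $D_{g_{red}}$). **Equisingular families of plane curves.** Let $D(x,y,s)$ be a convergent power series with parameter $s$. The family of plane curve germs $\{D(\cdot,\cdot,s)=0\}$ at $0\in\mathbb C^2$ is *equisingular* (with respect to the projection $(x,y)\mapsto x$) if $D$ is regular in $y$, i.e. $D(0,y,0)\not\equiv 0$, and either $D(0)\neq 0$, or $D(0,0,s)\equiv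 0$ and, for $E(x,s)=\Delta(D)$ (taken with respect to $y$), the multiplicity $\operatorname{mult}_{(0,s)}E$ is independent of small $s$. **Zariski equisingularity.** The family $V_t$ is *Zariski equisingular* in the coordinates $x,y,z$ if $f$ is regular in $z$ and the discriminant $\Delta(f)(x,y,t)$ (with respect to $z$) defines an equisingular family of plane curve germs with parameter $t$. **$\nu$-transversality.** For $b\in\mathbb{C}$ let $\pi_b(x,y,z)=(x,y-bz)$. In the coordinates $(X,Y,Z)=(x,y-bz,z)$ this is $(X,Y,Z)\mapsto (X,Y)$, so the discriminant locus of $\pi_b$ restricted to $\{g=0\}$ is the zero set of the discriminant with respect to $Z$ of $g(X,Y+bZ,Z)$. The coordinates $x,y,z$ are *$\nu$-transverse* for $V_0$ if (1) the $z$-axis is not contained in the tangent cone $C_0(V_0)$; (2) the $y$-axis is not contained in the tangent cone at $0$ of the discriminant locus of $\pi_0|_{V_0}$; (3) the discriminant loci of $\pi_b|_{V_0}$ form an equisingular family of plane curve germs with parameter $b\in(\mathbb{C},0)$. The family $V_t$ is *$\nu$-transverse Zariski equisingular* if $x,y,z$ are $\nu$-transverse for $V_0$ and the discriminant loci $\Delta_{b,t}$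 of the projections $(x,y,z,t)\mapsto(x,y-bz,t)$, i.e. of $f_t(X,Y+bZ,Z)$ with respect to $Z$, form an equisingular family of plane curve germs jointly in the parameters $(b,t)\in(\mathbb{C}\times\mathbb{C}^l,0)$. **Lemma.** Suppose that there is a non-empty Zariski open subset $U\subset GL_3(\mathbb{C})$ such that for every linear change of coordinates $A\in U$ the family defined by $f_t\circ A$ is Zariski equisingular. Then there is a non-empty Zariski open subset $U'\subset GL_3(\mathbb{C})$ such that for every $A\in U'$ the family defined by $f_t\circ A$ is $\nu$-transverse Zariski equisingular. -/

import Mathlib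

open Polynomial Topology Filter

noncomputable section

/-! Germs of complex analytic functions are represented by functions that are analytic at the
origin of a complex normed space; all identities between them are required near the origin. -/

/-- The `k`-th root of a complex polynomial `p` (roots are listed with multiplicity, in some
order, `k < p.natDegree`). -/
def rootOf (p : ℂ[X]) (k : ℕ) : ℂ := p.roots.toList.getD k 0

/-- The `i`-th generalized discriminant (subdiscriminant) of a monic complex polynomial of
degree `d` with roots `ξ₁, …, ξ_d`: the sum, over all sets `S` of `d - i + 1` indices, of
`∏_{k < l, k, l ∈ S} (ξ_k - ξ_l) ^ 2`.  For `i = 1` it is the usual discriminant. -/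
def genDiscr (p : ℂ[X]) (i : ℕ) : ℂ :=
  ∑ S ∈ Finset.powersetCard (p.natDegree + 1 - i) (Finset.range p.natDegree),
    ∏ kl ∈ (S ×ˢ S).filter (fun kl => kl.1 < kl.2), (rootOf p kl.1 - rootOf p kl.2) ^ 2

/-- `W` is the Weierstrass polynomial, in the last variable, of the germ `g` at `0`:
`g = u * W` near `0`, where `u` is analytic with `u(0) ≠ 0` and `W` is monic, its lower
coefficients being analytic functions of the other variables that vanish at `0`. -/
def IsWeierstrassPoly {B : Type*} [NormedAddCommGroup B] [NormedSpace ℂ B]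
    (g : B × ℂ → ℂ) (W : B → ℂ[X]) : Prop :=
  ∃ (d : ℕ) (a : Fin d → B → ℂ) (u : B × ℂ → ℂ),
    (∀ i, AnalyticAt ℂ (a i) 0 ∧ a i 0 = 0) ∧
    (∀ b, W b = X ^ d + ∑ i : Fin d, C (a i b) * X ^ (i : ℕ)) ∧
    AnalyticAt ℂ u 0 ∧ u 0 ≠ 0 ∧
    ∀ᶠ q in 𝓝 (0 : B × ℂ), g q = u q * (W q.1).eval q.2

/-- `D` is the first generalized discriminant, with respect to the last variable, of the germ
`g` that does not vanish identically near `0`.  It is the usual discriminant if `g` is reduced,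
and a nonzero constant multiple of the discriminant of `g_red` in general. -/
def IsFirstDiscr {B : Type*} [NormedAddCommGroup B] [NormedSpace ℂ B]
    (g : B × ℂ → ℂ) (D : B → ℂ) : Prop :=
  ∃ W : B → ℂ[X], IsWeierstrassPoly g W ∧ ∃ i : ℕ, 1 ≤ i ∧
    (∀ j, 1 ≤ j → j < i → ∀ᶠ b in 𝓝 (0 : B), genDiscr (W b) j = 0) ∧
    (¬ ∀ᶠ b in 𝓝 (0 : B), genDiscr (W b) i = 0) ∧
    D = fun b => genDiscr (W b) i

/-- Multiplicity (order of vanishing) at the point `p` of a function analytic at `p`. -/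
def mult {E : Type*} [NormedAddCommGroup E] [NormedSpace ℂ E] (g : E → ℂ) (p : E) : ℕ∞ :=
  ⨅ (k : ℕ) (_ : iteratedFDeriv ℂ k g p ≠ 0), (k : ℕ∞)

/-- The tangent cone at `0` of the hypersurface germ `g = 0`: the zero set of the initial form
of `g` at `0`. -/
def tangentConeZero {E : Type*} [NormedAddCommGroup E] [NormedSpace ℂ E] (g : E → ℂ) : Set E :=
  {v | ∀ m : ℕ, mult g 0 = m → iteratedFDeriv ℂ m g 0 (fun _ => v) = 0}

/-- The plane curve germs `D(·, ·, t) = 0` at the origin of `ℂ²` form an equisingular family,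
with respect to the parameter `t ∈ (P, 0)` and the projection `(x, y) ↦ x`, where `D` is a
function of `(x, y, t)`: `D` is regular in `y`, and either `D` is a unit, or `D(0, 0, t) = 0`
for all small `t` and the first nonzero generalized discriminant of `D` with respect to `y` is
equimultiple along `{x = 0}`. -/
def IsEquisingularCurveFamily {P : Type*} [NormedAddCommGroup P] [NormedSpace ℂ P]
    (D : ℂ × ℂ × P → ℂ) : Prop :=
  (¬ ∀ᶠ y in 𝓝 (0 : ℂ), D (0, y, 0) = 0) ∧
  (D 0 ≠ 0 ∨
    ((∀ᶠ t in 𝓝 (0 : P), D (0, 0, t) = 0) ∧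
      ∃ E : ℂ × P → ℂ,
        IsFirstDiscr (fun q : (ℂ × P) × ℂ => D (q.1.1, q.2, q.1.2)) E ∧
        ∀ᶠ t in 𝓝 (0 : P), mult E (0, t) = mult E 0))

/-- The family of surface germs `V_t = {f(·, t) = 0}` at the origin of `ℂ³`, parametrized by
`t ∈ (P, 0)`, is Zariski equisingular in the coordinates `x, y, z`: the discriminant loci of
the projections `(x, y, z) ↦ (x, y)` form an equisingular family of plane curve germs.
(Regularity of `f` in `z` is part of the existence of the Weierstrass polynomial.) -/
def IsZariskiEquisingular {P : Type*} [NormedAddCommGroup P] [NormedSpace ℂ P]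
    (f : (Fin 3 → ℂ) × P → ℂ) : Prop :=
  ∃ D : ℂ × ℂ × P → ℂ,
    IsFirstDiscr (fun q : (ℂ × ℂ × P) × ℂ => f (![q.1.1, q.1.2.1, q.2], q.1.2.2)) D ∧
    IsEquisingularCurveFamily D

/-- `(X, Y, Z) ↦ (X, Y + bZ, Z)`.  In the coordinates `X, Y, Z` the projection
`π_b(x, y, z) = (x, y - bz)` is the projection `(X, Y, Z) ↦ (X, Y)`. -/
def shear (b : ℂ) (v : Fin 3 → ℂ) : Fin 3 → ℂ := ![v 0, v 1 + b * v 2, v 2]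

/-- The coordinates `x, y, z` are `ν`-transverse (nested uniformly transverse) for the surface
germ `V = {g = 0}`: the `z`-axis is transverse to `V`, the `y`-axis is transverse to the
discriminant locus `Δ_0` of `(x, y, z) ↦ (x, y)` restricted to `V`, and the discriminant loci
`Δ_b` of the restrictions to `V` of the projections `π_b(x, y, z) = (x, y - bz)` form an
equisingular family of plane curve germs for small `b`. -/
def IsNuTransverse (g : (Fin 3 → ℂ) → ℂ) : Prop :=
  ![0, 0, 1] ∉ tangentConeZero g ∧
  (∃ D : ℂ × ℂ → ℂ,
    IsFirstDiscr (fun q : (ℂ × ℂ) × ℂ => g ![q.1.1, q.1.2, q.2]) D ∧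
    ((0, 1) : ℂ × ℂ) ∉ tangentConeZero D) ∧
  ∃ Δ : ℂ × ℂ × ℂ → ℂ,
    IsFirstDiscr
      (fun q : (ℂ × ℂ × ℂ) × ℂ => g (shear q.1.2.2 ![q.1.1, q.1.2.1, q.2])) Δ ∧
    IsEquisingularCurveFamily Δ

/-- The family `V_t = {f(·, t) = 0}` is `ν`-transverse Zariski equisingular: the coordinates are
`ν`-transverse for `V_0`, and the discriminant loci `Δ_{b,t}` of the projections
`(x, y, z, t) ↦ (x, y - bz, t)` form an equisingular family of plane curve germs, jointly in
the parameters `(b, t)` near `(0, 0)`. -/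
def IsNuTransverseZariskiEquisingular {P : Type*} [NormedAddCommGroup P] [NormedSpace ℂ P]
    (f : (Fin 3 → ℂ) × P → ℂ) : Prop :=
  IsNuTransverse (fun v => f (v, 0)) ∧
  ∃ Δ : ℂ × ℂ × (ℂ × P) → ℂ,
    IsFirstDiscr
      (fun q : (ℂ × ℂ × (ℂ × P)) × ℂ =>
        f (shear q.1.2.2.1 ![q.1.1, q.1.2.1, q.2], q.1.2.2.2)) Δ ∧
    IsEquisingularCurveFamily Δ

/-- Zariski open subsets of `GL₃(ℂ)`. -/
def IsZariskiOpen (U : Set (Matrix.GeneralLinearGroup (Fin 3) ℂ)) : Prop :=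
  ∃ S : Set (MvPolynomial (Fin 3 × Fin 3) ℂ),
    U = {A : Matrix.GeneralLinearGroup (Fin 3) ℂ | ∃ p ∈ S, MvPolynomial.eval
      (fun ij => (A : Matrix (Fin 3) (Fin 3) ℂ) ij.1 ij.2) p ≠ 0}

/-- A property holds for a generic linear change of coordinates: it holds on a nonempty (hence
dense) Zariski open subset of `GL₃(ℂ)`. -/
def HoldsGenerically (Q : Matrix.GeneralLinearGroup (Fin 3) ℂ → Prop) : Prop :=
  ∃ U, IsZariskiOpen U ∧ U.Nonempty ∧ ∀ A ∈ U, Q A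

/-- The family `f` in new coordinates `v`, related to the old ones by the linear change `A v`. -/
def linearChange {P : Type*} (f : (Fin 3 → ℂ) × P → ℂ)
    (A : Matrix.GeneralLinearGroup (Fin 3) ℂ) : (Fin 3 → ℂ) × P → ℂ :=
  fun q => f ((A : Matrix (Fin 3) (Fin 3) ℂ).mulVec q.1, q.2)

end

/-! To a linear change `A` for which the family is Zariski equisingular, attach five integers: the
order `d` of `f_0 ∘ A` in `z`; the index `i` of the first nonzero generalized discriminant `D`; the
order `m` of `D(0, y, 0)` in `y`; the index `j` of the first nonzero generalized discriminant `E` of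
`D`; and the order `M` of `E(x, 0)` in `x`. Equimultiplicity of `E` along `x = 0` means that `E`
vanishes there to order exactly `M` in `x`, also for small `t ≠ 0`. This is the content of
`HasSurfaceType`.

These integers are generically constant. The Taylor coefficients of `f_0 ∘ A` are polynomials in the
entries of `A`. Comparing coefficients in `g = u * W` shows that those of the Weierstrass polynomial
are rational in `A`, the only denominators being powers of the leading coefficient of `g(0, z)`
(`HasWeierstrass.iteratedDeriv_mem`), and generalized discriminants are polynomials in the
coefficients of `W`. Each integer is thus detected by the nonvanishing of regular functions of `A`
and takes its minimal value on a principal open set (`exists_locus_const`). Doing this for `d`, then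
`(i, m)`, then `(j, M)` gives a set `Locus h` on which all five are constant
(`exists_locus_hasSurfaceType`). All these functions are read off at `t = 0`, so the neighbourhood
of `t = 0` on which equisingularity holds may depend on `A`.

Constancy implies equisingularity in `(b, t)`: composing `A` with a small shear stays in `Locus h`,
so all slices `b = const` have the same type. Since the order in `z` does not drop, the Weierstrass
polynomial of the joint germ, supplied by the preparation theorem with parameters, restricts to
those of the slices. Vanishing on the slices then gives vanishing of the joint germ, and the orders
`m` and `M` are inherited (`HasSurfaceType.joint`).

Constancy also implies transversality: if the order along an axis is the same for all nearby
positions of the axis, then every homogeneous part of lower degree vanishes on an open set of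
directions, hence identically. The order is therefore the multiplicity, and the axis is not in the
tangent cone. -/

noncomputable section

attribute [local fun_prop] analyticAt_fst analyticAt_snd

/-! ### Taylor series in one and two variables, and their restrictions to lines. -/

/-- The Taylor series at `0` of a function of one complex variable. -/
def taylorSeries (φ : ℂ → ℂ) : PowerSeries ℂ :=
  PowerSeries.mk fun k => iteratedDeriv k φ 0 / (k.factorial : ℂ)

lemma coeff_taylorSeries (φ : ℂ → ℂ) (k : ℕ) :
    PowerSeries.coeff k (taylorSeries φ) = iteratedDeriv k φ 0 / (k.factorial : ℂ) := by
  simp [taylorSeries]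

lemma coeff_taylorSeries_eq_zero_iff (φ : ℂ → ℂ) (k : ℕ) :
    PowerSeries.coeff k (taylorSeries φ) = 0 ↔ iteratedDeriv k φ 0 = 0 := by
  simp [coeff_taylorSeries, Nat.factorial_ne_zero]

lemma taylorSeries_congr {φ ψ : ℂ → ℂ} (h : φ =ᶠ[𝓝 0] ψ) : taylorSeries φ = taylorSeries ψ := by
  ext k
  rw [coeff_taylorSeries, coeff_taylorSeries, h.iteratedDeriv_eq]

lemma taylorSeries_mul {φ ψ : ℂ → ℂ} (hφ : AnalyticAt ℂ φ 0) (hψ : AnalyticAt ℂ ψ 0) :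
    taylorSeries (fun z => φ z * ψ z) = taylorSeries φ * taylorSeries ψ := by
  ext k
  have := iteratedDeriv_mul (n := k) hφ.contDiffAt hψ.contDiffAt
  rw [coeff_taylorSeries, PowerSeries.coeff_mul, show (fun z => φ z * ψ z) = φ * ψ from rfl, this,
    Finset.Nat.sum_antidiagonal_eq_sum_range_succ_mk, Finset.sum_div]
  refine Finset.sum_congr rfl fun i hi => ?_
  have hi : i ≤ k := by simpa [Nat.lt_succ_iff] using hi
  rw [coeff_taylorSeries, coeff_taylorSeries, Nat.cast_choose ℂ hi]
  have h1 : (k.factorial : ℂ) ≠ 0 := by exact_mod_cast k.factorial_ne_zero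
  field_simp

lemma taylorSeries_add {φ ψ : ℂ → ℂ} (hφ : AnalyticAt ℂ φ 0) (hψ : AnalyticAt ℂ ψ 0) :
    taylorSeries (fun z => φ z + ψ z) = taylorSeries φ + taylorSeries ψ := by
  ext k
  rw [map_add, coeff_taylorSeries, coeff_taylorSeries, coeff_taylorSeries,
    show (fun z => φ z + ψ z) = φ + ψ from rfl,
    iteratedDeriv_add hφ.contDiffAt hψ.contDiffAt, add_div]

lemma taylorSeries_const (c : ℂ) : taylorSeries (fun _ => c) = PowerSeries.C c := by
  ext k
  rw [coeff_taylorSeries, iteratedDeriv_const, PowerSeries.coeff_C]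
  split_ifs with h <;> simp [h]

lemma taylorSeries_sum {ι : Type*} (I : Finset ι) {φ : ι → ℂ → ℂ}
    (hφ : ∀ i ∈ I, AnalyticAt ℂ (φ i) 0) :
    taylorSeries (fun z => ∑ i ∈ I, φ i z) = ∑ i ∈ I, taylorSeries (φ i) := by
  classical
  induction I using Finset.induction_on with
  | empty => simp [taylorSeries_const]
  | insert a I ha ih =>
    simp only [Finset.sum_insert ha]
    rw [taylorSeries_add (hφ _ (by simp)) (Finset.analyticAt_fun_sum _ fun i hi => hφ i (by simp [hi])),
      ih fun i hi => hφ i (by simp [hi])]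

lemma taylorSeries_pow (n : ℕ) : taylorSeries (fun z => z ^ n) = PowerSeries.X ^ n := by
  ext k
  rw [coeff_taylorSeries, iteratedDeriv_fun_pow_zero, PowerSeries.coeff_X_pow]
  by_cases h : k = n
  · subst h
    simp [Nat.factorial_ne_zero]
  · simp [h]

/-- The derivative in the second variable. -/
def derivSnd (G : ℂ × ℂ → ℂ) : ℂ × ℂ → ℂ := fun q => fderiv ℂ G q (0, 1)

/-- The derivative in the first variable. -/
def derivFst (G : ℂ × ℂ → ℂ) : ℂ × ℂ → ℂ := fun q => fderiv ℂ G q (1, 0)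

lemma analyticAt_derivSnd {G : ℂ × ℂ → ℂ} {q : ℂ × ℂ} (hG : AnalyticAt ℂ G q) :
    AnalyticAt ℂ (derivSnd G) q :=
  ((ContinuousLinearMap.apply ℂ ℂ ((0, 1) : ℂ × ℂ)).analyticAt _).comp hG.fderiv

lemma analyticAt_derivFst {G : ℂ × ℂ → ℂ} {q : ℂ × ℂ} (hG : AnalyticAt ℂ G q) :
    AnalyticAt ℂ (derivFst G) q :=
  ((ContinuousLinearMap.apply ℂ ℂ ((1, 0) : ℂ × ℂ)).analyticAt _).comp hG.fderiv

lemma deriv_snd_eq {G : ℂ × ℂ → ℂ} {s z : ℂ} (hG : AnalyticAt ℂ G (s, z)) :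
    deriv (fun w => G (s, w)) z = derivSnd G (s, z) := by
  have h1 : HasDerivAt (fun w : ℂ => ((s, w) : ℂ × ℂ)) (0, 1) z :=
    (hasDerivAt_const z s).prodMk (hasDerivAt_id z)
  exact (hG.differentiableAt.hasFDerivAt.comp_hasDerivAt z h1).deriv

lemma deriv_fst_eq {G : ℂ × ℂ → ℂ} {s z : ℂ} (hG : AnalyticAt ℂ G (s, z)) :
    deriv (fun w => G (w, z)) s = derivFst G (s, z) := by
  have h1 : HasDerivAt (fun w : ℂ => ((w, z) : ℂ × ℂ)) (1, 0) s :=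
    (hasDerivAt_id s).prodMk (hasDerivAt_const s z)
  exact (hG.differentiableAt.hasFDerivAt.comp_hasDerivAt s h1).deriv

lemma tendsto_prodMk_zero : Tendsto (fun s : ℂ => ((s, 0) : ℂ × ℂ)) (𝓝 0) (𝓝 0) :=
  (by fun_prop : Continuous fun s : ℂ => ((s, 0) : ℂ × ℂ)).tendsto' 0 0 rfl

lemma iteratedDeriv_succ_snd {G : ℂ × ℂ → ℂ} (hG : AnalyticAt ℂ G 0) (j : ℕ) :
    (fun s => iteratedDeriv (j + 1) (fun z => G (s, z)) 0) =ᶠ[𝓝 0]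
      fun s => iteratedDeriv j (fun z => derivSnd G (s, z)) 0 := by
  have h := tendsto_prodMk_zero.eventually hG.eventually_analyticAt.eventually_nhds
  filter_upwards [h] with s hs
  rw [iteratedDeriv_succ']
  refine Filter.EventuallyEq.iteratedDeriv_eq _ ?_
  have h2 : Tendsto (fun z : ℂ => ((s, z) : ℂ × ℂ)) (𝓝 0) (𝓝 (s, 0)) :=
    (by fun_prop : Continuous fun z : ℂ => ((s, z) : ℂ × ℂ)).tendsto' 0 _ rfl
  filter_upwards [h2.eventually hs] with z hz
  exact deriv_snd_eq hz

lemma analyticAt_iteratedDeriv_snd {G : ℂ × ℂ → ℂ} (hG : AnalyticAt ℂ G 0) (j : ℕ) :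
    AnalyticAt ℂ (fun s => iteratedDeriv j (fun z => G (s, z)) 0) 0 := by
  induction j generalizing G with
  | zero =>
    simp only [iteratedDeriv_zero]
    exact AnalyticAt.fun_comp (g := G) (f := fun s : ℂ => (s, 0)) hG (by fun_prop)
  | succ j ih => exact (ih (analyticAt_derivSnd hG)).congr (iteratedDeriv_succ_snd hG j).symm

/-- The `(i, j)`-th mixed derivative at the origin. -/
def mixedDeriv (G : ℂ × ℂ → ℂ) (i j : ℕ) : ℂ :=
  iteratedDeriv i (fun s => iteratedDeriv j (fun z => G (s, z)) 0) 0

/-- The Taylor series at `0` of a function of `(s, z) ∈ ℂ²`, as a power series in `s` whose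
coefficients are power series in `z`. -/
def taylorSeries₂ (G : ℂ × ℂ → ℂ) : PowerSeries (PowerSeries ℂ) :=
  PowerSeries.mk fun i => PowerSeries.mk fun j =>
    mixedDeriv G i j / ((i.factorial : ℂ) * (j.factorial : ℂ))

lemma coeff_taylorSeries₂ (G : ℂ × ℂ → ℂ) (i j : ℕ) :
    PowerSeries.coeff j (PowerSeries.coeff i (taylorSeries₂ G)) =
      mixedDeriv G i j / ((i.factorial : ℂ) * (j.factorial : ℂ)) := by
  simp [taylorSeries₂]

/-- Reduces products in two variables to the one-variable Leibniz rule, applied first in `z` and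
then in `s`. -/
lemma coeff_taylorSeries₂' (G : ℂ × ℂ → ℂ) (i j : ℕ) :
    PowerSeries.coeff j (PowerSeries.coeff i (taylorSeries₂ G)) =
      PowerSeries.coeff i (taylorSeries fun s => PowerSeries.coeff j (taylorSeries fun z => G (s, z))) := by
  simp only [coeff_taylorSeries₂, coeff_taylorSeries, mixedDeriv, iteratedDeriv_div_const]
  rw [div_div, mul_comm]

lemma analyticAt_coeff_taylor_snd {G : ℂ × ℂ → ℂ} (hG : AnalyticAt ℂ G 0) (j : ℕ) :
    AnalyticAt ℂ (fun s => PowerSeries.coeff j (taylorSeries fun z => G (s, z))) 0 := by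
  simp only [coeff_taylorSeries]
  exact (analyticAt_iteratedDeriv_snd hG j).div_const

lemma taylorSeries₂_congr {G H : ℂ × ℂ → ℂ} (h : G =ᶠ[𝓝 0] H) : taylorSeries₂ G = taylorSeries₂ H := by
  ext i j
  rw [coeff_taylorSeries₂', coeff_taylorSeries₂']
  congr 1
  refine taylorSeries_congr ?_
  filter_upwards [tendsto_prodMk_zero.eventually h.eventually_nhds] with s hs
  congr 1
  have h2 : Tendsto (fun z : ℂ => ((s, z) : ℂ × ℂ)) (𝓝 0) (𝓝 (s, 0)) :=
    (by fun_prop : Continuous fun z : ℂ => ((s, z) : ℂ × ℂ)).tendsto' 0 _ rfl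
  exact taylorSeries_congr (h2.eventually hs)

lemma taylorSeries₂_mul {G H : ℂ × ℂ → ℂ} (hG : AnalyticAt ℂ G 0) (hH : AnalyticAt ℂ H 0) :
    taylorSeries₂ (fun q => G q * H q) = taylorSeries₂ G * taylorSeries₂ H := by
  ext i j
  have h1 : (fun s => PowerSeries.coeff j (taylorSeries fun z => G (s, z) * H (s, z))) =ᶠ[𝓝 0]
      fun s => ∑ p ∈ Finset.HasAntidiagonal.antidiagonal j, PowerSeries.coeff p.1 (taylorSeries fun z => G (s, z)) *
        PowerSeries.coeff p.2 (taylorSeries fun z => H (s, z)) := by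
    filter_upwards [tendsto_prodMk_zero.eventually hG.eventually_analyticAt,
      tendsto_prodMk_zero.eventually hH.eventually_analyticAt] with s hs hs'
    rw [taylorSeries_mul (AnalyticAt.fun_comp (g := G) (f := fun z : ℂ => (s, z)) hs (by fun_prop))
      (AnalyticAt.fun_comp (g := H) (f := fun z : ℂ => (s, z)) hs' (by fun_prop)),
      PowerSeries.coeff_mul]
  rw [coeff_taylorSeries₂', taylorSeries_congr h1, taylorSeries_sum _ fun p _ =>
    (analyticAt_coeff_taylor_snd hG _).fun_mul (analyticAt_coeff_taylor_snd hH _), map_sum,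
    PowerSeries.coeff_mul, map_sum]
  simp only [PowerSeries.coeff_mul, coeff_taylorSeries₂']
  rw [Finset.sum_comm]
  refine Finset.sum_congr rfl fun p _ => ?_
  rw [taylorSeries_mul (analyticAt_coeff_taylor_snd hG _) (analyticAt_coeff_taylor_snd hH _),
    PowerSeries.coeff_mul]

lemma mixedDeriv_derivSnd {G : ℂ × ℂ → ℂ} (hG : AnalyticAt ℂ G 0) (i j : ℕ) :
    mixedDeriv (derivSnd G) i j = mixedDeriv G i (j + 1) :=
  (iteratedDeriv_succ_snd hG j).symm.iteratedDeriv_eq i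

lemma derivFst_derivSnd_comm {G : ℂ × ℂ → ℂ} {q : ℂ × ℂ} (hG : AnalyticAt ℂ G q) :
    derivFst (derivSnd G) q = derivSnd (derivFst G) q := by
  have h (v w : ℂ × ℂ) : fderiv ℂ (fun q => fderiv ℂ G q v) q w =
      fderiv ℂ (fderiv ℂ G) q w v := by
    have h1 := hG.fderiv.differentiableAt.hasFDerivAt
    have h2 := (ContinuousLinearMap.apply ℂ ℂ v).hasFDerivAt.comp q h1
    have h3 := h2.fderiv
    exact DFunLike.congr_fun h3 w
  have hs := hG.contDiffAt.isSymmSndFDerivAt (n := ⊤) le_top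
  unfold derivFst derivSnd
  rw [h, h]
  exact hs.eq _ _

lemma deriv_iteratedDeriv_snd {G : ℂ × ℂ → ℂ} (hG : AnalyticAt ℂ G 0) (j : ℕ) :
    deriv (fun s => iteratedDeriv j (fun z => G (s, z)) 0) =ᶠ[𝓝 0]
      fun s => iteratedDeriv j (fun z => derivFst G (s, z)) 0 := by
  induction j generalizing G with
  | zero =>
    filter_upwards [tendsto_prodMk_zero.eventually hG.eventually_analyticAt] with s hs
    simpa only [iteratedDeriv_zero] using deriv_fst_eq hs
  | succ j ih =>
    refine (iteratedDeriv_succ_snd hG j).deriv.trans ((ih (analyticAt_derivSnd hG)).trans ?_)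
    refine EventuallyEq.trans ?_ (iteratedDeriv_succ_snd (analyticAt_derivFst hG) j).symm
    filter_upwards [tendsto_prodMk_zero.eventually hG.eventually_analyticAt.eventually_nhds]
      with s hs
    have h2 : Tendsto (fun z : ℂ => ((s, z) : ℂ × ℂ)) (𝓝 0) (𝓝 (s, 0)) :=
      (by fun_prop : Continuous fun z : ℂ => ((s, z) : ℂ × ℂ)).tendsto' 0 _ rfl
    refine Filter.EventuallyEq.iteratedDeriv_eq _ ?_
    filter_upwards [h2.eventually hs] with z hz using derivFst_derivSnd_comm hz

lemma mixedDeriv_derivFst {G : ℂ × ℂ → ℂ} (hG : AnalyticAt ℂ G 0) (i j : ℕ) :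
    mixedDeriv (derivFst G) i j = mixedDeriv G (i + 1) j := by
  unfold mixedDeriv
  rw [iteratedDeriv_succ']
  exact (deriv_iteratedDeriv_snd hG j).symm.iteratedDeriv_eq i

lemma tendsto_line (a b : ℂ) : Tendsto (fun s : ℂ => ((s * a, s * b) : ℂ × ℂ)) (𝓝 0) (𝓝 0) :=
  (by fun_prop : Continuous fun s : ℂ => ((s * a, s * b) : ℂ × ℂ)).tendsto' 0 0 (by simp)

lemma analyticAt_comp_line {G : ℂ × ℂ → ℂ} (hG : AnalyticAt ℂ G 0) (a b : ℂ) :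
    AnalyticAt ℂ (fun s : ℂ => G (s * a, s * b)) 0 :=
  AnalyticAt.fun_comp_of_eq (g := G) (f := fun s : ℂ => (s * a, s * b)) hG (by fun_prop)
    (by simp)

/-- Each derivative along the line is `a ∂₁ + b ∂₂` by the chain rule; these operators commute, so
Pascal's rule produces the binomial expansion. -/
lemma iteratedDeriv_line_eq_sum {G : ℂ × ℂ → ℂ} (hG : AnalyticAt ℂ G 0) (a b : ℂ) (k : ℕ) :
    iteratedDeriv k (fun s => G (s * a, s * b)) 0 =
      ∑ p ∈ Finset.HasAntidiagonal.antidiagonal k,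
        (k.choose p.1 : ℂ) * (a ^ p.1 * b ^ p.2 * mixedDeriv G p.1 p.2) := by
  induction k generalizing G with
  | zero => simp [mixedDeriv]
  | succ k ih =>
    have h1 : deriv (fun s => G (s * a, s * b)) =ᶠ[𝓝 0]
        fun s => a * derivFst G (s * a, s * b) + b * derivSnd G (s * a, s * b) := by
      filter_upwards [(tendsto_line a b).eventually hG.eventually_analyticAt] with s hs
      have h1 : HasDerivAt (fun s : ℂ => ((s * a, s * b) : ℂ × ℂ)) (a, b) s := by
        simpa using ((hasDerivAt_id s).mul_const a).prodMk ((hasDerivAt_id s).mul_const b)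
      have h2 := (hs.differentiableAt.hasFDerivAt.comp_hasDerivAt s h1).deriv
      refine Eq.trans h2 ?_
      have h3 : ((a, b) : ℂ × ℂ) = a • (1, 0) + b • (0, 1) := by simp
      rw [h3, map_add, map_smul, map_smul]
      rfl
    have hF := analyticAt_comp_line (analyticAt_derivFst hG) a b
    have hS := analyticAt_comp_line (analyticAt_derivSnd hG) a b
    rw [iteratedDeriv_succ', h1.iteratedDeriv_eq]
    have h2 := iteratedDeriv_add (n := k) (analyticAt_const (v := a) |>.fun_mul hF).contDiffAt
      (analyticAt_const (v := b) |>.fun_mul hS).contDiffAt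
    refine Eq.trans h2 ?_
    rw [iteratedDeriv_const_mul_field, iteratedDeriv_const_mul_field,
      ih (analyticAt_derivFst hG), ih (analyticAt_derivSnd hG),
      Finset.sum_antidiagonal_choose_succ_mul
        (fun i j => a ^ i * b ^ j * mixedDeriv G i j) k, add_comm, Finset.mul_sum, Finset.mul_sum]
    congr 1
    · refine Finset.sum_congr rfl fun p _ => ?_
      rw [mixedDeriv_derivSnd hG]
      ring
    · refine Finset.sum_congr rfl fun p hp => ?_
      rw [mixedDeriv_derivFst hG, ← Finset.HasAntidiagonal.mem_antidiagonal.mp hp,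
        Nat.choose_symm_add]
      ring

/-- Evaluating at the distinct nodes `0, …, n - 1` gives an invertible Vandermonde system, so each
coefficient is a linear combination of values. -/
lemma mem_of_forall_sum_pow_mem {ι : Type*} (M : Submodule ℂ (ι → ℂ)) (n : ℕ)
    (c : Fin n → ι → ℂ) (h : ∀ a : ℂ, (∑ i : Fin n, a ^ (i : ℕ) • c i) ∈ M) (i : Fin n) : c i ∈ M := by
  set V := Matrix.vandermonde (fun i : Fin n => ((i : ℕ) : ℂ)) with hV
  have hdet : IsUnit V.det := by
    rw [isUnit_iff_ne_zero, hV, Matrix.det_vandermonde_ne_zero_iff]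
    intro i j hij
    exact Fin.ext (Nat.cast_injective (R := ℂ) hij)
  have h1 : c i = ∑ l, (V⁻¹ i l) • ∑ k, V l k • c k := by
    have h2 : ∀ k, ∑ l, V⁻¹ i l * V l k = if i = k then 1 else 0 := fun k => by
      rw [← Matrix.mul_apply, Matrix.nonsing_inv_mul V hdet, Matrix.one_apply]
    simp_rw [Finset.smul_sum, smul_smul]
    rw [Finset.sum_comm]
    simp_rw [← Finset.sum_smul, h2]
    simp
  rw [h1]
  exact M.sum_mem fun l _ => M.smul_mem _ (h (l : ℕ))

/-- If the Taylor coefficients of a family of functions along all lines through the origin lie in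
a submodule, then so do all mixed derivatives. -/
lemma mixedDeriv_mem_of_lines {ι : Type*} (M : Submodule ℂ (ι → ℂ)) {G : ι → ℂ × ℂ → ℂ}
    (hG : ∀ A, AnalyticAt ℂ (G A) 0)
    (h : ∀ a b k, (fun A => iteratedDeriv k (fun s => G A (s * a, s * b)) 0) ∈ M) (i j : ℕ) :
    (fun A => mixedDeriv (G A) i j) ∈ M := by
  -- Along `(a, 1)` the derivative of order `i + j` is a polynomial in `a` whose coefficients are
  -- the mixed derivatives of that total order, up to binomial factors.
  have h1 := mem_of_forall_sum_pow_mem M (i + j + 1)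
    (fun l A => ((i + j).choose l : ℂ) * mixedDeriv (G A) l (i + j - l)) (fun a => by
      convert h a 1 (i + j) using 1
      funext A
      rw [iteratedDeriv_line_eq_sum (hG A), Finset.Nat.sum_antidiagonal_eq_sum_range_succ_mk,
        Finset.sum_range, Finset.sum_apply]
      refine Finset.sum_congr rfl fun l _ => ?_
      simp
      ring) ⟨i, by omega⟩
  have h2 := M.smul_mem (((i + j).choose i : ℂ))⁻¹ h1
  convert h2 using 1
  funext A
  have h3 : ((i + j).choose i : ℂ) ≠ 0 := by
    exact_mod_cast (Nat.choose_pos (by omega : i ≤ i + j)).ne'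
  simp [h3]

/-! ### Weierstrass factorization of formal power series over a subring. -/

/-- Power series all of whose coefficients lie in a given subring. -/
def PowerSeries.coeffsIn {S : Type*} [CommRing S] (H : Subring S) : Subring (PowerSeries S) where
  carrier := {P | ∀ j, PowerSeries.coeff j P ∈ H}
  mul_mem' := fun {P Q} hP hQ j => by
    rw [PowerSeries.coeff_mul]
    exact H.sum_mem fun p _ => H.mul_mem (hP _) (hQ _)
  one_mem' := fun j => by
    rw [PowerSeries.coeff_one]
    split_ifs
    · exact H.one_mem
    · exact H.zero_mem
  add_mem' := fun {P Q} hP hQ j => by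
    rw [map_add]
    exact H.add_mem (hP j) (hQ j)
  zero_mem' := fun j => by simp [H.zero_mem]
  neg_mem' := fun {P} hP j => by
    rw [map_neg]
    exact H.neg_mem (hP j)

lemma PowerSeries.mem_coeffsIn {S : Type*} [CommRing S] {H : Subring S} {P : PowerSeries S} :
    P ∈ PowerSeries.coeffsIn H ↔ ∀ j, PowerSeries.coeff j P ∈ H := Iff.rfl

/-- The series comes from one over `H`, where its constant coefficient is a unit; it is inverted
there and mapped back. -/
lemma PowerSeries.exists_mul_eq_one_of_mem_coeffsIn {S : Type*} [CommRing S] {H : Subring S}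
    {P : PowerSeries S} (hP : P ∈ PowerSeries.coeffsIn H) {v : S} (hv : v ∈ H)
    (h : PowerSeries.coeff 0 P * v = 1) : ∃ Q ∈ PowerSeries.coeffsIn H, P * Q = 1 := by
  set P' : PowerSeries H := PowerSeries.mk fun j => ⟨_, hP j⟩
  have hP' : PowerSeries.map H.subtype P' = P := by
    ext j
    simp [P']
  have hu : IsUnit P' := by
    rw [PowerSeries.isUnit_iff_constantCoeff]
    refine IsUnit.of_mul_eq_one ⟨v, hv⟩ (Subtype.ext ?_)
    rw [← PowerSeries.coeff_zero_eq_constantCoeff_apply]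
    simpa [P'] using h
  obtain ⟨Q', hQ'⟩ := hu.exists_right_inv
  refine ⟨PowerSeries.map H.subtype Q', fun j => by simp, ?_⟩
  rw [← hP', ← map_mul, hQ', map_one]

/-- The coefficients of the distinguished factor of a power series lie in every subring that
contains the coefficients of the series and the inverse of the leading one. -/
lemma PowerSeries.coeff_mem_of_eq_mul {S : Type*} [CommRing S] (H : Subring S)
    {G U W : PowerSeries (PowerSeries S)} {d : ℕ} (hGUW : G = U * W)
    (hG : ∀ i, PowerSeries.coeff i G ∈ PowerSeries.coeffsIn H)
    (hW0 : PowerSeries.coeff 0 W = PowerSeries.X ^ d)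
    (hW : ∀ n, 0 < n → ∀ j, d ≤ j → PowerSeries.coeff j (PowerSeries.coeff n W) = 0)
    {v : S} (hv : v ∈ H) (hdv : PowerSeries.coeff d (PowerSeries.coeff 0 G) * v = 1) (n : ℕ) :
    PowerSeries.coeff n W ∈ PowerSeries.coeffsIn H := by
  have shift : ∀ P : PowerSeries S, P * PowerSeries.X ^ d ∈ PowerSeries.coeffsIn H →
      P ∈ PowerSeries.coeffsIn H := fun P hP j => by
    simpa using hP (j + d)
  have hG0 : PowerSeries.coeff 0 G = PowerSeries.coeff 0 U * PowerSeries.X ^ d := by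
    rw [hGUW, PowerSeries.coeff_mul]
    simp [hW0]
  have hU0 : PowerSeries.coeff 0 U ∈ PowerSeries.coeffsIn H := shift _ (hG0 ▸ hG 0)
  obtain ⟨V, hV, hUV⟩ := PowerSeries.exists_mul_eq_one_of_mem_coeffsIn hU0 hv (by
    rw [hG0] at hdv
    simpa [PowerSeries.coeff_mul_X_pow'] using hdv)
  have hX : (PowerSeries.X ^ d : PowerSeries S) ∈ PowerSeries.coeffsIn H := fun j => by
    rw [PowerSeries.coeff_X_pow]
    split_ifs
    · exact H.one_mem
    · exact H.zero_mem
  suffices h : PowerSeries.coeff n U ∈ PowerSeries.coeffsIn H ∧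
      PowerSeries.coeff n W ∈ PowerSeries.coeffsIn H from h.2
  induction n using Nat.strong_induction_on with
  | _ n ih =>
    rcases Nat.eq_zero_or_pos n with rfl | hn
    · exact ⟨hU0, hW0 ▸ hX⟩
    obtain ⟨m, rfl⟩ : ∃ m, n = m + 1 := ⟨n - 1, by omega⟩
    -- In the coefficient of order `m + 1` of `U * W` only two terms are not yet known to have
    -- coefficients in `H`.
    have h1 : PowerSeries.coeff (m + 1) U * PowerSeries.X ^ d +
        PowerSeries.coeff 0 U * PowerSeries.coeff (m + 1) W ∈ PowerSeries.coeffsIn H := by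
      have h2 : PowerSeries.coeff (m + 1) G =
          PowerSeries.coeff 0 U * PowerSeries.coeff (m + 1) W +
          (∑ p ∈ Finset.range m, PowerSeries.coeff (p + 1) U * PowerSeries.coeff (m - p) W) +
          PowerSeries.coeff (m + 1) U * PowerSeries.X ^ d := by
        rw [hGUW, PowerSeries.coeff_mul, Finset.Nat.sum_antidiagonal_eq_sum_range_succ_mk,
          Finset.sum_range_succ, Finset.sum_range_succ', ← hW0]
        simp [add_comm]
      have h3 := (PowerSeries.coeffsIn H).sub_mem (hG (m + 1))
        ((PowerSeries.coeffsIn H).sum_mem (t := Finset.range m)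
          (f := fun p => PowerSeries.coeff (p + 1) U * PowerSeries.coeff (m - p) W)
          fun p hp => (PowerSeries.coeffsIn H).mul_mem
            (ih (p + 1) (by simp at hp; omega)).1 (ih (m - p) (by omega)).2)
      rw [h2] at h3
      convert h3 using 1
      ring
    have h4 : PowerSeries.coeff (m + 1) W ∈ PowerSeries.coeffsIn H := fun j => by
      rcases le_or_gt d j with hj | hj
      · rw [hW _ hn j hj]
        exact H.zero_mem
      -- After multiplication by the inverse `V` of the constant term of `U`, the unknown part of
      -- `U` contributes only in degrees `≥ d`, whereas the unknown part of `W` lives in degrees `<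
      -- d`: the two separate.
      · have h5 := (PowerSeries.coeffsIn H).mul_mem hV h1 j
        have h6 : V * (PowerSeries.coeff (m + 1) U * PowerSeries.X ^ d +
            PowerSeries.coeff 0 U * PowerSeries.coeff (m + 1) W) =
            V * PowerSeries.coeff (m + 1) U * PowerSeries.X ^ d + PowerSeries.coeff (m + 1) W := by
          rw [mul_add, ← mul_assoc, ← mul_assoc, mul_comm V (PowerSeries.coeff 0 U), hUV, one_mul]
        rw [h6, map_add, PowerSeries.coeff_mul_X_pow', if_neg (by omega), zero_add] at h5
        exact h5
    refine ⟨shift _ ?_, h4⟩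
    have h7 := (PowerSeries.coeffsIn H).sub_mem h1 ((PowerSeries.coeffsIn H).mul_mem hU0 h4)
    rwa [add_sub_cancel_right] at h7

/-! ### Germs determined by their restrictions to lines. -/

section Lines
variable {E : Type*} [NormedAddCommGroup E] [NormedSpace ℂ E]

lemma iteratedDeriv_smul_line {g : E → ℂ} (hg : AnalyticAt ℂ g 0) (v : E) (k : ℕ) :
    iteratedDeriv k (fun s : ℂ => g (s • v)) 0 = iteratedFDeriv ℂ k g 0 (fun _ => v) := by
  obtain ⟨p, r, hp⟩ := hg
  set L : ℂ →L[ℂ] E := ContinuousLinearMap.toSpanSingleton ℂ v with hL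
  have hp' : HasFPowerSeriesOnBall g p (L 0) r := by simpa using hp
  have h2 := hp'.compContinuousLinearMap
  have h3 := h2.factorial_smul 1 k
  have h4 := hp.factorial_smul v k
  rw [iteratedFDeriv_apply_eq_iteratedDeriv_mul_prod] at h3
  rw [← h4]
  have h5 : (g ∘ L) = fun s : ℂ => g (s • v) := rfl
  rw [h5] at h3
  simp only [Finset.prod_const_one, one_smul] at h3
  rw [← h3]
  simp [FormalMultilinearSeries.compContinuousLinearMap, hL]

lemma analyticAt_smul_line {g : E → ℂ} (hg : AnalyticAt ℂ g 0) (v : E) :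
    AnalyticAt ℂ (fun s : ℂ => g (s • v)) 0 :=
  AnalyticAt.fun_comp_of_eq (g := g) (f := fun s : ℂ => s • v) hg (by fun_prop) (by simp)

/-- The Taylor expansion of `g` at `q` involves only the values of the derivatives on the diagonal
`(q, …, q)`. -/
lemma eventually_eq_zero_of_lines {g : E → ℂ} (hg : AnalyticAt ℂ g 0)
    (h : ∀ v k, iteratedDeriv k (fun s : ℂ => g (s • v)) 0 = 0) : ∀ᶠ q in 𝓝 (0 : E), g q = 0 := by
  have h' : ∀ v k, iteratedFDeriv ℂ k g 0 (fun _ => v) = 0 := fun v k => by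
    rw [← iteratedDeriv_smul_line hg, h]
  obtain ⟨p, r, hp⟩ := hg
  filter_upwards [Metric.eball_mem_nhds (0 : E) hp.r_pos] with q hq
  have h1 := hp.hasSum_iteratedFDeriv hq
  simp only [h', smul_zero, zero_add] at h1
  exact h1.unique hasSum_zero

end Lines

/-! ### Weierstrass polynomials: regularity of their coefficients, and uniqueness. -/

/-- The monic polynomial of degree `d` with given lower coefficients. -/
def monicPoly (d : ℕ) (c : Fin d → ℂ) : ℂ[X] := X ^ d + ∑ i : Fin d, C (c i) * X ^ (i : ℕ)

lemma coeff_monicPoly_of_lt {d : ℕ} (c : Fin d → ℂ) (i : Fin d) : (monicPoly d c).coeff i = c i := by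
  simp only [monicPoly, coeff_add, coeff_X_pow, finsetSum_coeff, coeff_C_mul]
  rw [if_neg i.2.ne, zero_add, Finset.sum_eq_single i]
  · simp
  · intro j _ hj
    rw [if_neg fun h => hj (Fin.ext h.symm), mul_zero]
  · simp

lemma coeff_monicPoly_of_le {d : ℕ} (c : Fin d → ℂ) {j : ℕ} (h : d ≤ j) :
    (monicPoly d c).coeff j = if j = d then 1 else 0 := by
  simp only [monicPoly, coeff_add, coeff_X_pow, finsetSum_coeff, coeff_C_mul]
  rw [Finset.sum_eq_zero, add_zero]
  intro i _
  rw [if_neg (by omega), mul_zero]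

lemma monicPoly_zero (d : ℕ) : monicPoly d 0 = X ^ d := by simp [monicPoly]

lemma taylorSeries_eval (p : ℂ[X]) : taylorSeries (fun z => p.eval z) = (p : PowerSeries ℂ) := by
  induction p using Polynomial.induction_on' with
  | add p q hp hq =>
    simp only [eval_add, coe_add]
    rw [taylorSeries_add (AnalyticOnNhd.eval_polynomial p 0 trivial)
      (AnalyticOnNhd.eval_polynomial q 0 trivial), hp, hq]
  | monomial n a =>
    simp only [eval_monomial]
    rw [taylorSeries_mul analyticAt_const (ψ := fun z => z ^ n) (analyticAt_id.fun_pow n), taylorSeries_const,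
      taylorSeries_pow, ← Polynomial.C_mul_X_pow_eq_monomial, coe_mul, coe_C, coe_pow, coe_X]

section Weierstrass
variable {B : Type*} [NormedAddCommGroup B] [NormedSpace ℂ B]

/-- The germ `g` has a Weierstrass polynomial of degree `d` whose lower coefficients are `a`. -/
def HasWeierstrass (g : B × ℂ → ℂ) (d : ℕ) (a : B → Fin d → ℂ) : Prop :=
  (∀ i, AnalyticAt ℂ (fun b => a b i) 0) ∧ a 0 = 0 ∧ ∃ u : B × ℂ → ℂ,
    AnalyticAt ℂ u 0 ∧ u 0 ≠ 0 ∧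
    ∀ᶠ q in 𝓝 (0 : B × ℂ), g q = u q * (monicPoly d (a q.1)).eval q.2

lemma isWeierstrassPoly_iff {g : B × ℂ → ℂ} {W : B → ℂ[X]} :
    IsWeierstrassPoly g W ↔
      ∃ d a, HasWeierstrass g d a ∧ W = fun b => monicPoly d (a b) := by
  constructor
  · rintro ⟨d, a, u, ha, hW, hu, hu0, h⟩
    refine ⟨d, fun b i => a i b, ⟨fun i => (ha i).1, funext fun i => (ha i).2, u, hu, hu0, ?_⟩,
      funext hW⟩
    filter_upwards [h] with q hq
    rw [hq, hW]
    rfl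
  · rintro ⟨d, a, ⟨ha, ha0, u, hu, hu0, h⟩, rfl⟩
    exact ⟨d, fun i b => a b i, u, fun i => ⟨ha i, congrFun ha0 i⟩, fun b => rfl, hu, hu0, h⟩

lemma AnalyticAt.eval_monicPoly {F : Type*} [NormedAddCommGroup F] [NormedSpace ℂ F] {d : ℕ}
    {a : F → Fin d → ℂ} {w : F → ℂ} {x : F} (ha : ∀ i, AnalyticAt ℂ (fun b => a b i) x)
    (hw : AnalyticAt ℂ w x) : AnalyticAt ℂ (fun q => (monicPoly d (a q)).eval (w q)) x := by
  simp only [monicPoly, eval_add, eval_pow, eval_X, eval_finsetSum, eval_mul, eval_C]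
  exact (hw.fun_pow d).fun_add (Finset.analyticAt_fun_sum _ fun i _ => (ha i).fun_mul (hw.fun_pow i))

lemma tendsto_line_fst (v : B) :
    Tendsto (fun q : ℂ × ℂ => ((q.1 • v, q.2) : B × ℂ)) (𝓝 0) (𝓝 0) :=
  (by fun_prop : Continuous fun q : ℂ × ℂ => ((q.1 • v, q.2) : B × ℂ)).tendsto' 0 0 (by simp)

lemma analyticAt_line_fst {g : B × ℂ → ℂ} (hg : AnalyticAt ℂ g 0) (v : B) :
    AnalyticAt ℂ (fun q : ℂ × ℂ => g (q.1 • v, q.2)) 0 :=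
  AnalyticAt.fun_comp_of_eq (g := g) (f := fun q : ℂ × ℂ => (q.1 • v, q.2)) hg (by fun_prop)
    (by simp)

lemma HasWeierstrass.analyticAt {g : B × ℂ → ℂ} {d : ℕ} {a : B → Fin d → ℂ}
    (h : HasWeierstrass g d a) : AnalyticAt ℂ g 0 := by
  obtain ⟨ha, ha0, u, hu, hu0, h⟩ := h
  refine (hu.fun_mul (AnalyticAt.eval_monicPoly (a := fun q : B × ℂ => a q.1) (w := fun q => q.2)
    (fun i => ?_) (by fun_prop))).congr (h.mono fun q hq => hq.symm)
  exact AnalyticAt.fun_comp_of_eq (g := fun b => a b i) (f := fun q : B × ℂ => q.1) (ha i)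
    (by fun_prop) rfl

lemma HasWeierstrass.taylorSeries_eq {g : B × ℂ → ℂ} {d : ℕ} {a : B → Fin d → ℂ}
    (h : HasWeierstrass g d a) : ∃ U : PowerSeries ℂ, PowerSeries.coeff 0 U ≠ 0 ∧
      taylorSeries (fun z => g (0, z)) = U * PowerSeries.X ^ d := by
  obtain ⟨ha, ha0, u, hu, hu0, h⟩ := h
  have h1 : Tendsto (fun z : ℂ => ((0, z) : B × ℂ)) (𝓝 0) (𝓝 0) :=
    (by fun_prop : Continuous fun z : ℂ => ((0, z) : B × ℂ)).tendsto' 0 0 rfl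
  have h2 : AnalyticAt ℂ (fun z : ℂ => u (0, z)) 0 :=
    AnalyticAt.fun_comp_of_eq (g := u) (f := fun z : ℂ => (0, z)) hu (by fun_prop) rfl
  refine ⟨taylorSeries fun z => u (0, z), by simpa [coeff_taylorSeries] using (show u (0, 0) ≠ 0 from hu0), ?_⟩
  rw [← taylorSeries_pow, ← taylorSeries_mul h2 (by fun_prop)]
  refine taylorSeries_congr ?_
  filter_upwards [h1.eventually h] with z hz
  rw [hz]
  simp [ha0, monicPoly_zero]

lemma HasWeierstrass.iteratedDeriv_eq_zero {g : B × ℂ → ℂ} {d : ℕ} {a : B → Fin d → ℂ}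
    (h : HasWeierstrass g d a) {j : ℕ} (hj : j < d) :
    iteratedDeriv j (fun z => g (0, z)) 0 = 0 := by
  obtain ⟨U, -, hU⟩ := h.taylorSeries_eq
  rw [← coeff_taylorSeries_eq_zero_iff, hU, PowerSeries.coeff_mul_X_pow', if_neg (by omega)]

lemma HasWeierstrass.iteratedDeriv_ne_zero {g : B × ℂ → ℂ} {d : ℕ} {a : B → Fin d → ℂ}
    (h : HasWeierstrass g d a) : iteratedDeriv d (fun z => g (0, z)) 0 ≠ 0 := by
  obtain ⟨U, hU0, hU⟩ := h.taylorSeries_eq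
  rw [Ne, ← coeff_taylorSeries_eq_zero_iff, hU, PowerSeries.coeff_mul_X_pow']
  simpa using hU0

/-- The Taylor coefficients, along a line, of the coefficients of the Weierstrass polynomials of a
family of germs lie in every algebra that contains the Taylor coefficients of the family and the
inverse of the leading one. -/
lemma HasWeierstrass.iteratedDeriv_mem {ι : Type*} (M : Subalgebra ℂ (ι → ℂ))
    {g : ι → B × ℂ → ℂ} {d : ℕ} {a : ι → B → Fin d → ℂ} (h : ∀ A, HasWeierstrass (g A) d (a A))
    (v : B)
    (hg : ∀ i j, (fun A => mixedDeriv (fun q : ℂ × ℂ => g A (q.1 • v, q.2)) i j) ∈ M)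
    (hd : (fun A => (iteratedDeriv d (fun z => g A (0, z)) 0)⁻¹) ∈ M) (i : Fin d) (k : ℕ) :
    (fun A => iteratedDeriv k (fun s : ℂ => a A (s • v) i) 0) ∈ M := by
  have hlead := fun A => (h A).iteratedDeriv_ne_zero
  choose ha ha0 u hu hu0 hgu using h
  have hav : ∀ A i, AnalyticAt ℂ (fun s : ℂ => a A (s • v) i) 0 := fun A i =>
    analyticAt_smul_line (ha A i) v
  set w : ι → ℂ × ℂ → ℂ := fun A q => (monicPoly d (a A (q.1 • v))).eval q.2 with hw
  have hwa : ∀ A, AnalyticAt ℂ (w A) 0 := fun A =>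
    AnalyticAt.eval_monicPoly (a := fun q : ℂ × ℂ => a A (q.1 • v)) (w := fun q => q.2)
      (fun i => AnalyticAt.fun_comp_of_eq (g := fun s : ℂ => a A (s • v) i)
        (f := fun q : ℂ × ℂ => q.1) (hav A i) (by fun_prop) rfl) (by fun_prop)
  -- The series of all members of the family are bundled into one series over the ring `ι → ℂ`, so
  -- that membership in `M` becomes a statement about coefficients in a subring.
  let fam (G : ι → ℂ × ℂ → ℂ) : PowerSeries (PowerSeries (ι → ℂ)) :=
    PowerSeries.mk fun i => PowerSeries.mk fun j => fun A =>
      PowerSeries.coeff j (PowerSeries.coeff i (taylorSeries₂ (G A)))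
  have hfam : ∀ G A, PowerSeries.map (PowerSeries.map (Pi.evalRingHom (fun _ : ι => ℂ) A)) (fam G)
      = taylorSeries₂ (G A) := fun G A => by
    ext i j
    simp [fam]
  have hprod : fam (fun A q => g A (q.1 • v, q.2)) =
      fam (fun A q => u A (q.1 • v, q.2)) * fam w := by
    have key : ∀ A, taylorSeries₂ (fun q : ℂ × ℂ => g A (q.1 • v, q.2)) =
        taylorSeries₂ (fun q : ℂ × ℂ => u A (q.1 • v, q.2)) * taylorSeries₂ (w A) := fun A => by
      rw [← taylorSeries₂_mul (analyticAt_line_fst (hu A) v) (hwa A)]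
      refine taylorSeries₂_congr ?_
      filter_upwards [(tendsto_line_fst v).eventually (hgu A)] with q hq using hq
    refine PowerSeries.ext fun i => PowerSeries.ext fun j => funext fun A => ?_
    have h1 := hfam (fun A q => g A (q.1 • v, q.2)) A
    rw [key A, ← hfam (fun A q => u A (q.1 • v, q.2)) A, ← hfam w A, ← map_mul] at h1
    have h2 := congrArg (fun P => PowerSeries.coeff j (PowerSeries.coeff i P)) h1
    simpa only [PowerSeries.coeff_map, Pi.evalRingHom_apply] using h2
  have hcoefw : ∀ A i j, PowerSeries.coeff j (PowerSeries.coeff i (taylorSeries₂ (w A))) =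
      PowerSeries.coeff i (taylorSeries fun s => (monicPoly d (a A (s • v))).coeff j) := by
    intro A i j
    rw [coeff_taylorSeries₂']
    simp only [hw, taylorSeries_eval, Polynomial.coeff_coe]
  have hres := PowerSeries.coeff_mem_of_eq_mul M.toSubring hprod
    (fun i => PowerSeries.mem_coeffsIn.2 fun j => ?_) (d := d) ?_ ?_ (M.smul_mem hd (d.factorial : ℂ))
    ?_ k i
  · have h1 : (fun A => PowerSeries.coeff i (PowerSeries.coeff k (taylorSeries₂ (w A)))) ∈ M := by
      simpa [fam] using hres
    simp only [hcoefw, coeff_monicPoly_of_lt, coeff_taylorSeries] at h1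
    convert M.smul_mem h1 (k.factorial : ℂ) using 1
    funext A
    have : (k.factorial : ℂ) ≠ 0 := by exact_mod_cast k.factorial_ne_zero
    simp only [Pi.smul_apply, smul_eq_mul]
    field_simp
  · simp only [fam, PowerSeries.coeff_mk, coeff_taylorSeries₂]
    refine (congrArg (· ∈ M) ?_).mp (M.smul_mem (hg i j) (((i.factorial : ℂ) * (j.factorial : ℂ))⁻¹))
    funext A
    simp only [Pi.smul_apply, smul_eq_mul]
    ring
  · refine PowerSeries.ext fun j => funext fun A => ?_
    simp only [fam, PowerSeries.coeff_mk, hcoefw, coeff_taylorSeries, iteratedDeriv_zero,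
      zero_smul, ha0, monicPoly_zero, coeff_X_pow, PowerSeries.coeff_X_pow]
    split_ifs <;> simp
  · intro n hn j hj
    funext A
    simp only [fam, PowerSeries.coeff_mk, hcoefw, coeff_monicPoly_of_le _ hj, taylorSeries_const,
      PowerSeries.coeff_C, if_neg hn.ne', Pi.zero_apply]
  · funext A
    have : (d.factorial : ℂ) ≠ 0 := by exact_mod_cast d.factorial_ne_zero
    simp only [fam, PowerSeries.coeff_mk, coeff_taylorSeries₂, mixedDeriv, iteratedDeriv_zero,
      zero_smul, Pi.mul_apply, Pi.smul_apply, smul_eq_mul, Pi.one_apply, Nat.factorial_zero,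
      Nat.cast_one, one_mul]
    have := hlead A
    field_simp

/-- Uniqueness is the regularity statement for the constant family indexed by `Bool`, with `M` the
algebra of functions taking equal values at `true` and `false`. -/
lemma HasWeierstrass.eventuallyEq {g : B × ℂ → ℂ} {d : ℕ} {a a' : B → Fin d → ℂ}
    (h : HasWeierstrass g d a) (h' : HasWeierstrass g d a') : ∀ᶠ b in 𝓝 (0 : B), a b = a' b := by
  let M : Subalgebra ℂ (Bool → ℂ) :=
    AlgHom.equalizer (Pi.evalAlgHom ℂ (fun _ : Bool => ℂ) true) (Pi.evalAlgHom ℂ _ false)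
  have h1 : ∀ v i k, iteratedDeriv k (fun s : ℂ => a (s • v) i) 0 =
      iteratedDeriv k (fun s : ℂ => a' (s • v) i) 0 := fun v i k =>
    HasWeierstrass.iteratedDeriv_mem M (g := fun _ => g) (a := fun A => if A then a else a')
      (fun A => by cases A <;> simpa) v (fun _ _ => rfl) rfl i k
  have h2 : ∀ i, ∀ᶠ b in 𝓝 (0 : B), a b i = a' b i := fun i => by
    have h3 := eventually_eq_zero_of_lines ((h.1 i).fun_sub (h'.1 i)) fun v k => by
      have h4 := iteratedDeriv_sub (n := k) (analyticAt_smul_line (h.1 i) v).contDiffAt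
        (analyticAt_smul_line (h'.1 i) v).contDiffAt
      refine Eq.trans h4 ?_
      rw [h1, sub_self]
    filter_upwards [h3] with b hb using sub_eq_zero.1 hb
  filter_upwards [eventually_all.2 h2] with b hb using funext hb

end Weierstrass

/-! ### Generalized discriminants as polynomials in the coefficients. -/

section GenDiscr

lemma Finset.offDiag_map_embedding {α β : Type*} [DecidableEq α] [DecidableEq β] (e : α ↪ β)
    (S : Finset α) : (S.map e).offDiag = S.offDiag.map (e.prodMap e) := by
  ext ⟨a, b⟩
  simp only [Finset.mem_offDiag, Finset.mem_map, Function.Embedding.coe_prodMap, Prod.exists,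
    Prod.map_apply, Prod.mk.injEq]
  constructor
  · rintro ⟨⟨x, hx, rfl⟩, ⟨y, hy, rfl⟩, h⟩
    exact ⟨x, y, ⟨hx, hy, fun h' => h (h' ▸ rfl)⟩, rfl, rfl⟩
  · rintro ⟨x, y, ⟨hx, hy, h⟩, rfl, rfl⟩
    exact ⟨⟨x, hx, rfl⟩, ⟨y, hy, rfl⟩, fun h' => h (e.injective h')⟩

/-- Pairing `(k, l)` with `(l, k)` trades the ordering of the roots for a sign depending only on the
size of `S`; the product over `S.offDiag` is visibly invariant under permutations. -/
lemma Finset.prod_filter_lt_sq {α R : Type*} [LinearOrder α] [CommRing R] (x : α → R)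
    (S : Finset α) :
    ∏ kl ∈ (S ×ˢ S).filter (fun kl => kl.1 < kl.2), (x kl.1 - x kl.2) ^ 2 =
      (-1) ^ ((S.card * S.card - S.card) / 2) * ∏ kl ∈ S.offDiag, (x kl.1 - x kl.2) := by
  set T := (S ×ˢ S).filter (fun kl => kl.1 < kl.2) with hT
  set T' := T.map (Equiv.prodComm α α).toEmbedding with hT'
  have hdisj : Disjoint T T' := by
    rw [Finset.disjoint_left]
    rintro ⟨a, b⟩ h h'
    simp only [hT, hT', Finset.mem_map_equiv, Finset.mem_filter, Equiv.prodComm_symm,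
      Equiv.prodComm_apply, Prod.swap] at h h'
    exact lt_asymm h.2 h'.2
  have hunion : S.offDiag = T.disjUnion T' hdisj := by
    ext ⟨a, b⟩
    simp only [hT, hT', Finset.mem_disjUnion, Finset.mem_map_equiv, Finset.mem_filter,
      Equiv.prodComm_symm, Equiv.prodComm_apply, Prod.swap, Finset.mem_offDiag,
      Finset.mem_product]
    rcases lt_trichotomy a b with h | h | h
    · simp [h, h.ne, h.le.not_gt]
    · simp [h]
    · simp [h, h.ne', h.le.not_gt, and_comm]
  have hcard : (S.card * S.card - S.card) / 2 = T.card := by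
    rw [← Finset.offDiag_card, hunion, Finset.card_disjUnion, hT', Finset.card_map]
    omega
  rw [hcard, hunion, Finset.prod_disjUnion, hT', Finset.prod_map, ← Finset.prod_mul_distrib,
    ← Finset.prod_const, ← Finset.prod_mul_distrib]
  refine Finset.prod_congr rfl fun kl _ => ?_
  simp only [Equiv.coe_toEmbedding, Equiv.prodComm_apply, Prod.fst_swap, Prod.snd_swap]
  ring

lemma natDegree_monicPoly (d : ℕ) (c : Fin d → ℂ) : (monicPoly d c).natDegree = d := by
  refine le_antisymm (natDegree_le_iff_coeff_eq_zero.2 fun j hj => ?_) (le_natDegree_of_ne_zero ?_)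
  · rw [coeff_monicPoly_of_le c hj.le, if_neg hj.ne']
  · rw [coeff_monicPoly_of_le c le_rfl]
    simp

lemma monic_monicPoly (d : ℕ) (c : Fin d → ℂ) : (monicPoly d c).Monic := by
  rw [Monic, leadingCoeff, natDegree_monicPoly, coeff_monicPoly_of_le c le_rfl, if_pos rfl]

/-- The generalized discriminants of a monic polynomial are polynomials in its coefficients. -/
lemma exists_mvPolynomial_genDiscr (d i : ℕ) : ∃ P : MvPolynomial (Fin d) ℂ,
    ∀ c : Fin d → ℂ, genDiscr (monicPoly d c) i = MvPolynomial.eval c P := by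
  set n := d + 1 - i with hn
  set Q : MvPolynomial (Fin d) ℂ := ∑ S ∈ Finset.powersetCard n Finset.univ,
    ∏ kl ∈ S.offDiag, (MvPolynomial.X kl.1 - MvPolynomial.X kl.2) with hQ
  have hsymm : Q.IsSymmetric := by
    intro e
    simp only [hQ, map_sum, map_prod, map_sub, MvPolynomial.rename_X]
    have h1 : Finset.powersetCard n (Finset.univ : Finset (Fin d)) =
        (Finset.powersetCard n Finset.univ).map (Finset.mapEmbedding e.toEmbedding).toEmbedding := by
      rw [← Finset.powersetCard_map, Finset.map_univ_equiv]
    conv_rhs => rw [h1]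
    rw [Finset.sum_map]
    refine Finset.sum_congr rfl fun S _ => ?_
    simp only [RelEmbedding.coe_toEmbedding, Finset.mapEmbedding_apply]
    rw [Finset.offDiag_map_embedding, Finset.prod_map]
    rfl
  obtain ⟨P, hP⟩ := MvPolynomial.esymmAlgHom_surjective (σ := Fin d) (n := d) ℂ (by simp)
    ⟨Q, (MvPolynomial.mem_symmetricSubalgebra Q).2 hsymm⟩
  have hP' : MvPolynomial.aeval (fun k : Fin d => MvPolynomial.esymm (Fin d) ℂ (k + 1)) P = Q := by
    rw [← MvPolynomial.esymmAlgHom_apply, hP]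
  -- By Vieta, the elementary symmetric function of degree `k + 1` of the roots is `(-1) ^ (k + 1)`
  -- times the coefficient of degree `d - 1 - k`, which is the index `Fin.rev k`.
  refine ⟨MvPolynomial.C ((-1) ^ ((n * n - n) / 2)) *
    MvPolynomial.aeval (fun k : Fin d => MvPolynomial.C ((-1) ^ ((k : ℕ) + 1)) *
      MvPolynomial.X (Fin.rev k)) P, fun c => ?_⟩
  set p := monicPoly d c with hp
  have hcard : p.roots.card = p.natDegree := splits_iff_card_roots.mp (IsAlgClosed.splits p)
  have hlen : p.roots.toList.length = d := by
    rw [Multiset.length_toList, hcard, natDegree_monicPoly]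
  set ξ : Fin d → ℂ := fun k => rootOf p k with hξ
  have hroots : Finset.univ.val.map ξ = p.roots := by
    rw [Fin.univ_val_map, ← Multiset.coe_toList p.roots]
    congr 1
    refine List.ext_getElem (by simp [hlen]) fun k h1 h2 => ?_
    simp [hξ, rootOf, List.getElem?_eq_getElem h2]
  have h1 : genDiscr p i = (-1) ^ ((n * n - n) / 2) * MvPolynomial.eval ξ Q := by
    have h2 : Finset.range d = Finset.univ.map (Fin.valEmbedding (n := d)) := by
      ext k
      simp
    rw [genDiscr, natDegree_monicPoly, ← hn, h2, Finset.powersetCard_map, Finset.sum_map, hQ,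
      map_sum, Finset.mul_sum]
    refine Finset.sum_congr rfl fun S hS => ?_
    rw [Finset.prod_filter_lt_sq]
    simp only [RelEmbedding.coe_toEmbedding, Finset.mapEmbedding_apply, Finset.card_map]
    rw [Finset.offDiag_map_embedding, Finset.prod_map, (Finset.mem_powersetCard.1 hS).2, map_prod]
    simp [hξ]
  rw [h1, map_mul, MvPolynomial.eval_C]
  congr 1
  rw [← hP', ← MvPolynomial.coe_aeval_eq_eval, ← MvPolynomial.coe_aeval_eq_eval]
  simp only [RingHom.coe_coe]
  rw [← AlgHom.comp_apply, ← AlgHom.comp_apply, MvPolynomial.comp_aeval, MvPolynomial.comp_aeval]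
  congr 2
  funext k
  rw [MvPolynomial.aeval_esymm_eq_multiset_esymm, hroots, map_mul, MvPolynomial.aeval_C,
    MvPolynomial.aeval_X, ← coeff_monicPoly_of_lt c (Fin.rev k), ← hp,
    coeff_eq_esymm_roots_of_card hcard (by rw [natDegree_monicPoly]; exact (Fin.rev k).2.le),
    (monic_monicPoly d c).leadingCoeff, natDegree_monicPoly]
  have h3 : d - (Fin.rev k : ℕ) = k + 1 := by
    rw [Fin.val_rev]
    omega
  rw [h3, one_mul, ← mul_assoc]
  simp [← mul_pow]

end GenDiscr

/-! ### Analytic division by the generic monic polynomial, through Cauchy integrals. -/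

section Superposition
variable {K : Type*} [TopologicalSpace K] [CompactSpace K]
  {E : Type*} [NormedAddCommGroup E] [NormedSpace ℂ E]

/-- A multilinear form acts pointwise on continuous functions. -/
def ContinuousMultilinearMap.pointwise {n : ℕ} (p : E [×n]→L[ℂ] ℂ) :
    C(K, E) [×n]→L[ℂ] C(K, ℂ) :=
  MultilinearMap.mkContinuous
    { toFun := fun φ => ⟨fun k => p fun i => φ i k, p.cont.comp (by fun_prop)⟩
      map_update_add' := fun φ i x y => by
        ext k
        have h (w : C(K, E)) : (fun j => Function.update φ i w j k) =
            Function.update (fun j => φ j k) i (w k) := by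
          funext j
          by_cases hj : j = i
          · subst hj; simp
          · simp [hj]
        simp only [ContinuousMap.coe_mk, ContinuousMap.add_apply]
        exact (congrArg p (h (x + y))).trans ((p.map_update_add _ i (x k) (y k)).trans
          (congrArg₂ (· + ·) (congrArg p (h x)).symm (congrArg p (h y)).symm))
      map_update_smul' := fun φ i c x => by
        ext k
        have h (w : C(K, E)) : (fun j => Function.update φ i w j k) =
            Function.update (fun j => φ j k) i (w k) := by
          funext j
          by_cases hj : j = i
          · subst hj; simp
          · simp [hj]
        simp only [ContinuousMap.coe_mk, ContinuousMap.smul_apply]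
        exact (congrArg p (h (c • x))).trans ((p.map_update_smul _ i c (x k)).trans
          (congrArg (c • ·) (congrArg p (h x)).symm)) } ‖p‖ fun φ => by
    rw [ContinuousMap.norm_le _ (by positivity)]
    intro k
    refine (p.le_opNorm _).trans ?_
    gcongr with i
    exact (φ i).norm_coe_le_norm k

lemma ContinuousMultilinearMap.norm_pointwise_le {n : ℕ} (p : E [×n]→L[ℂ] ℂ) :
    ‖(p.pointwise : C(K, E) [×n]→L[ℂ] C(K, ℂ))‖ ≤ ‖p‖ :=
  MultilinearMap.mkContinuous_norm_le _ (norm_nonneg _) _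

/-- Superposition with an analytic function is analytic on spaces of continuous functions. -/
lemma exists_superposition {g : E → ℂ} {p : FormalMultilinearSeries ℂ E ℂ}
    {ρ : NNReal} (hp : HasFPowerSeriesOnBall g p 0 ρ) :
    ∃ 𝒢 : C(K, E) → C(K, ℂ), (∀ φ, ‖φ‖ < ρ → AnalyticAt ℂ 𝒢 φ) ∧
      ∀ φ, ‖φ‖ < ρ → ∀ k, 𝒢 φ k = g (φ k) := by
  set P : FormalMultilinearSeries ℂ C(K, E) C(K, ℂ) := fun n => (p n).pointwise with hP
  have hrad : (ρ : ENNReal) ≤ P.radius := by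
    refine hp.r_le.trans (ENNReal.le_of_forall_nnreal_lt fun r hr => ?_)
    obtain ⟨C, -, hC⟩ := p.norm_mul_pow_le_of_lt_radius hr
    refine P.le_radius_of_bound C fun n => le_trans ?_ (hC n)
    gcongr
    exact (p n).norm_pointwise_le
  have hball : ∀ φ : C(K, E), ‖φ‖ < ρ → φ ∈ Metric.eball 0 P.radius := fun φ hφ => by
    refine Metric.eball_subset_eball hrad ?_
    rw [Metric.mem_eball, edist_zero_right, enorm_lt_coe]
    exact hφ
  have hpos : 0 < P.radius := hp.r_pos.trans_le hrad
  refine ⟨P.sum, fun φ hφ => (P.hasFPowerSeriesOnBall hpos).analyticOnNhd _ (hball φ hφ), ?_⟩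
  intro φ hφ k
  have h1 := (P.hasSum (hball φ hφ)).mapL (ContinuousMap.evalCLM ℂ k)
  have h2 : φ k ∈ Metric.eball (0 : E) ρ := by
    rw [Metric.mem_eball, edist_zero_right, enorm_lt_coe]
    exact (φ.norm_coe_le_norm k).trans_lt hφ
  have h3 := hp.hasSum h2
  rw [zero_add] at h3
  exact h1.unique h3

end Superposition

section Circle

/-- The Cauchy functional `h ↦ (2πi)⁻¹ ∮ h(ζ) dζ` on continuous functions on a circle. -/
def cauchyFunctional {r : ℝ} (hr : 0 < r) : C(Metric.sphere (0 : ℂ) r, ℂ) →L[ℂ] ℂ :=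
  LinearMap.mkContinuous
    { toFun := fun h => (2 * Real.pi * Complex.I)⁻¹ • ∫ θ in (0 : ℝ)..2 * Real.pi,
        deriv (circleMap 0 r) θ • h ⟨circleMap 0 r θ, circleMap_mem_sphere 0 hr.le θ⟩
      map_add' := fun h h' => by
        rw [← smul_add, ← intervalIntegral.integral_add]
        · simp only [ContinuousMap.add_apply, smul_add]
        all_goals
          refine Continuous.intervalIntegrable ?_ _ _
          simp only [deriv_circleMap]
          fun_prop
      map_smul' := fun c h => by
        have h1 (a w : ℂ) : a • c • w = c • a • w := smul_comm _ _ _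
        simp only [ContinuousMap.smul_apply, RingHom.id_apply, h1, intervalIntegral.integral_smul] }
    (‖(2 * Real.pi * Complex.I)⁻¹‖ * (r * (2 * Real.pi))) fun h => by
      simp only [LinearMap.coe_mk, AddHom.coe_mk]
      have hI : ‖∫ θ in (0 : ℝ)..2 * Real.pi,
          deriv (circleMap 0 r) θ • h ⟨circleMap 0 r θ, circleMap_mem_sphere 0 hr.le θ⟩‖ ≤
          r * ‖h‖ * |2 * Real.pi - 0| := by
        refine intervalIntegral.norm_integral_le_of_norm_le_const fun θ _ => ?_
        rw [norm_smul, deriv_circleMap]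
        gcongr
        · simp [abs_of_pos hr]
        · exact h.norm_coe_le_norm _
      rw [sub_zero, abs_of_pos Real.two_pi_pos] at hI
      rw [norm_smul]
      exact (mul_le_mul_of_nonneg_left hI (norm_nonneg _)).trans_eq (by ring)

lemma cauchyFunctional_apply {r : ℝ} (hr : 0 < r) (h : C(Metric.sphere (0 : ℂ) r, ℂ)) (F : ℂ → ℂ)
    (hF : ∀ k, h k = F k) :
    cauchyFunctional hr h = (2 * Real.pi * Complex.I)⁻¹ • ∮ ζ in C(0, r), F ζ := by
  change (2 * Real.pi * Complex.I)⁻¹ • ∫ θ in (0 : ℝ)..2 * Real.pi,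
        deriv (circleMap 0 r) θ • h ⟨circleMap 0 r θ, circleMap_mem_sphere 0 hr.le θ⟩ = _
  simp only [hF]
  rfl

end Circle

lemma AnalyticAt.ringInverse {F A : Type*} [NormedAddCommGroup F] [NormedSpace ℂ F]
    [NormedRing A] [NormedAlgebra ℂ A] [CompleteSpace A] {φ : F → A} {x : F}
    (hφ : AnalyticAt ℂ φ x) (h : IsUnit (φ x)) : AnalyticAt ℂ (fun w => Ring.inverse (φ w)) x := by
  obtain ⟨u, hu⟩ := h
  have h1 : AnalyticAt ℂ Ring.inverse (φ x) := hu ▸ analyticAt_inverse (𝕜 := ℂ) u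
  exact AnalyticAt.fun_comp h1 hφ

section Division
variable {B : Type*} [NormedAddCommGroup B] [NormedSpace ℂ B]

/-- `(p(x) - p(z)) / (x - z)`, expanded in powers of `z`, for `p = ∑ c k * X ^ k`. -/
lemma sub_mul_sum_divided_difference {A : Type*} [CommRing A] (c : ℕ → A) (d : ℕ) (x z : A) :
    (x - z) * ∑ i : Fin d, z ^ (i : ℕ) *
      ∑ k ∈ Finset.range (d + 1), (if (i : ℕ) < k then c k * x ^ (k - 1 - i) else 0) =
    ∑ k ∈ Finset.range (d + 1), c k * x ^ k - ∑ k ∈ Finset.range (d + 1), c k * z ^ k := by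
  rw [← Finset.sum_sub_distrib, Fin.sum_univ_eq_sum_range (fun i => z ^ i *
    ∑ k ∈ Finset.range (d + 1), (if i < k then c k * x ^ (k - 1 - i) else 0)) d]
  simp_rw [Finset.mul_sum]
  rw [Finset.sum_comm]
  refine Finset.sum_congr rfl fun k hk => ?_
  have hk : k ≤ d := by simpa [Nat.lt_succ_iff] using hk
  have h1 : ∑ i ∈ Finset.range d, (x - z) * (z ^ i * (if i < k then c k * x ^ (k - 1 - i) else 0))
      = ∑ i ∈ Finset.range k, (x - z) * (z ^ i * (c k * x ^ (k - 1 - i))) := by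
    rw [← Finset.sum_subset (Finset.range_subset_range.2 hk)]
    · refine Finset.sum_congr rfl fun i hi => ?_
      rw [if_pos (Finset.mem_range.1 hi)]
    · intro i _ hi
      rw [if_neg (by simpa using hi), mul_zero, mul_zero]
  rw [h1, ← mul_sub, ← neg_sub (z ^ k) (x ^ k), ← geom_sum₂_mul z x k, Finset.sum_mul,
    ← Finset.sum_neg_distrib, Finset.mul_sum]
  refine Finset.sum_congr rfl fun i _ => ?_
  ring

/-- Division of an analytic germ by the generic monic polynomial, with analytic quotient and
remainder. -/
lemma exists_generic_division {g : B × ℂ → ℂ} (hg : AnalyticAt ℂ g 0) (d : ℕ) :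
    ∃ (q : (B × (Fin d → ℂ)) × ℂ → ℂ) (R : Fin d → B × (Fin d → ℂ) → ℂ),
      AnalyticAt ℂ q 0 ∧ (∀ i, AnalyticAt ℂ (R i) 0) ∧
      ∀ᶠ w in 𝓝 (0 : (B × (Fin d → ℂ)) × ℂ), g (w.1.1, w.2) =
        q w * (monicPoly d w.1.2).eval w.2 + ∑ i, R i w.1 * w.2 ^ (i : ℕ) := by
  obtain ⟨p, ρ', hp'⟩ := hg
  obtain ⟨ρ, hρ0, hρ'⟩ := ENNReal.lt_iff_exists_nnreal_btwn.1 hp'.r_pos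
  have hp : HasFPowerSeriesOnBall g p 0 ρ := hp'.mono hρ0 hρ'.le
  have hρ : (0 : ℝ) < ρ := by exact_mod_cast hρ0
  obtain ⟨r, hr, hrρ⟩ := exists_between hρ
  set K := Metric.sphere (0 : ℂ) r with hK
  obtain ⟨𝒢, h𝒢a, h𝒢⟩ := exists_superposition (K := K) hp
  let inc : C(K, ℂ) := ⟨fun k => k, by fun_prop⟩
  let L : B →L[ℂ] C(K, B × ℂ) := LinearMap.mkContinuous
    { toFun := fun b => ContinuousMap.const K (b, 0)
      map_add' := fun b b' => by ext k <;> simp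
      map_smul' := fun c b => by ext k <;> simp } 1 fun b => by
        rw [one_mul, ContinuousMap.norm_le _ (norm_nonneg _)]
        intro k
        simp [Prod.norm_def]
  let φ0 : C(K, B × ℂ) := ⟨fun k => (0, (k : ℂ)), by fun_prop⟩
  let φ : B → C(K, B × ℂ) := fun b => L b + φ0
  have hφ : ∀ b k, φ b k = (b, (k : ℂ)) := fun b k => by
    change ((b, 0) : B × ℂ) + (0, (k : ℂ)) = _
    simp
  have hφa : ∀ b, AnalyticAt ℂ φ b := fun b => (L.analyticAt b).fun_add analyticAt_const
  have hφ0n : ‖φ 0‖ < ρ := by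
    refine lt_of_le_of_lt ((ContinuousMap.norm_le _ hr.le).2 fun k => ?_) hrρ
    rw [hφ, Prod.norm_def]
    have : ‖(k : ℂ)‖ = r := by simp
    simp [this, hr.le]
  have hφn : ∀ᶠ b in 𝓝 (0 : B), ‖φ b‖ < ρ :=
    ((hφa 0).continuousAt.norm).eventually_lt continuousAt_const hφ0n
  let pc : (Fin d → ℂ) → C(K, ℂ) := fun c => inc ^ d + ∑ i, c i • inc ^ (i : ℕ)
  let zc : ℂ → C(K, ℂ) := fun z => inc - z • 1
  have hpc : ∀ c k, pc c k = (monicPoly d c).eval (k : ℂ) := fun c k => by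
    simp [pc, inc, monicPoly, eval_finsetSum]
  have hpca : ∀ c, AnalyticAt ℂ pc c := fun c => by
    refine analyticAt_const.fun_add (Finset.analyticAt_fun_sum _ fun i _ => ?_)
    exact (ContinuousLinearMap.proj (R := ℂ) (φ := fun _ : Fin d => ℂ) i).analyticAt c |>.smul
      analyticAt_const
  have hzca : ∀ z, AnalyticAt ℂ zc z := fun z =>
    analyticAt_const.sub (analyticAt_id.smul analyticAt_const)
  have hKne : ∀ k : K, (k : ℂ) ≠ 0 := fun k hk => by
    have : ‖(k : ℂ)‖ = r := by simp
    rw [hk, norm_zero] at this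
    exact hr.ne this
  have hincu : IsUnit inc := (ContinuousMap.isUnit_iff_forall_ne_zero _).2 hKne
  have hpc0 : IsUnit (pc 0) := by
    have : pc 0 = inc ^ d := by simp [pc]
    rw [this]
    exact hincu.pow d
  have hzc0 : IsUnit (zc 0) := by
    have : zc 0 = inc := by simp [zc]
    rwa [this]
  let cf (c : Fin d → ℂ) (k : ℕ) : ℂ := (monicPoly d c).coeff k
  let rc : Fin d → (Fin d → ℂ) → C(K, ℂ) := fun i c =>
    ∑ k ∈ Finset.range (d + 1),
      (if (i : ℕ) < k then cf c k • (inc : C(K, ℂ)) ^ (k - 1 - i) else 0)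
  have hcfa : ∀ k, AnalyticAt ℂ (fun c => cf c k) 0 := fun k => by
    rcases lt_or_ge k d with h | h
    · simp only [cf, fun c => coeff_monicPoly_of_lt c ⟨k, h⟩]
      exact (ContinuousLinearMap.proj (R := ℂ) (φ := fun _ : Fin d => ℂ) ⟨k, h⟩).analyticAt 0
    · simp only [cf, fun c => coeff_monicPoly_of_le (d := d) c h]
      exact analyticAt_const
  have hrca : ∀ i, AnalyticAt ℂ (rc i) 0 := fun i => by
    refine Finset.analyticAt_fun_sum _ fun k _ => ?_
    split_ifs
    · exact (hcfa k).smul analyticAt_const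
    · exact analyticAt_const
  let I := cauchyFunctional hr
  -- With `p_c` the generic polynomial, the quotient is the Cauchy integral of `g(b, ζ) / (p_c(ζ) (ζ
  -- - z))`, and `R i` is that of `g(b, ζ) / p_c(ζ)` times the coefficient of `z ^ i` in `(p_c(ζ) -
  -- p_c(z)) / (ζ - z)`. For small `c` and `z` the denominators are units of the Banach algebra
  -- `C(K, ℂ)`, which gives analyticity.
  let q : (B × (Fin d → ℂ)) × ℂ → ℂ := fun w =>
    I (𝒢 (φ w.1.1) * Ring.inverse (pc w.1.2) * Ring.inverse (zc w.2))
  let R : Fin d → B × (Fin d → ℂ) → ℂ := fun i w =>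
    I (𝒢 (φ w.1) * Ring.inverse (pc w.2) * rc i w.2)
  have hGa : AnalyticAt ℂ (fun b => 𝒢 (φ b)) 0 := AnalyticAt.fun_comp (h𝒢a _ hφ0n) (hφa 0)
  have hPa : AnalyticAt ℂ (fun c => Ring.inverse (pc c)) 0 := (hpca 0).ringInverse hpc0
  have hZa : AnalyticAt ℂ (fun z => Ring.inverse (zc z)) 0 := (hzca 0).ringInverse hzc0
  refine ⟨q, R, ?_, fun i => ?_, ?_⟩
  · refine (I.analyticAt _).fun_comp ?_
    refine AnalyticAt.fun_mul (AnalyticAt.fun_mul ?_ ?_) ?_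
    · exact AnalyticAt.fun_comp_of_eq (g := fun b => 𝒢 (φ b))
        (f := fun w : (B × (Fin d → ℂ)) × ℂ => w.1.1) hGa (by fun_prop) rfl
    · exact AnalyticAt.fun_comp_of_eq (g := fun c => Ring.inverse (pc c))
        (f := fun w : (B × (Fin d → ℂ)) × ℂ => w.1.2) hPa (by fun_prop) rfl
    · exact AnalyticAt.fun_comp_of_eq (g := fun z => Ring.inverse (zc z))
        (f := fun w : (B × (Fin d → ℂ)) × ℂ => w.2) hZa (by fun_prop) rfl
  · refine (I.analyticAt _).fun_comp ?_
    refine AnalyticAt.fun_mul (AnalyticAt.fun_mul ?_ ?_) ?_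
    · exact AnalyticAt.fun_comp_of_eq (g := fun b => 𝒢 (φ b))
        (f := fun w : B × (Fin d → ℂ) => w.1) hGa (by fun_prop) rfl
    · exact AnalyticAt.fun_comp_of_eq (g := fun c => Ring.inverse (pc c))
        (f := fun w : B × (Fin d → ℂ) => w.2) hPa (by fun_prop) rfl
    · exact AnalyticAt.fun_comp_of_eq (g := rc i)
        (f := fun w : B × (Fin d → ℂ) => w.2) (hrca i) (by fun_prop) rfl
  have hb : Tendsto (fun w : (B × (Fin d → ℂ)) × ℂ => w.1.1) (𝓝 0) (𝓝 0) :=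
    (by fun_prop : Continuous fun w : (B × (Fin d → ℂ)) × ℂ => w.1.1).tendsto' 0 0 rfl
  have hc : Tendsto (fun w : (B × (Fin d → ℂ)) × ℂ => w.1.2) (𝓝 0) (𝓝 0) :=
    (by fun_prop : Continuous fun w : (B × (Fin d → ℂ)) × ℂ => w.1.2).tendsto' 0 0 rfl
  have hz : Tendsto (fun w : (B × (Fin d → ℂ)) × ℂ => w.2) (𝓝 0) (𝓝 0) :=
    (by fun_prop : Continuous fun w : (B × (Fin d → ℂ)) × ℂ => w.2).tendsto' 0 0 rfl
  have hpcu : ∀ᶠ c in 𝓝 (0 : Fin d → ℂ), IsUnit (pc c) :=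
    (hpca 0).continuousAt.eventually (Units.isOpen.mem_nhds hpc0)
  have hzcu : ∀ᶠ z in 𝓝 (0 : ℂ), IsUnit (zc z) :=
    (hzca 0).continuousAt.eventually (Units.isOpen.mem_nhds hzc0)
  filter_upwards [hb.eventually hφn, hb.eventually (Metric.ball_mem_nhds (0 : B) hρ),
    hc.eventually hpcu, hz.eventually hzcu, hz.eventually (Metric.ball_mem_nhds (0 : ℂ) hr)]
    with ⟨⟨b, c⟩, z⟩ hbn hbρ hcu hzu hzr
  simp only at hbn hbρ hcu hzu hzr ⊢
  have hcauchy : I (𝒢 (φ b) * Ring.inverse (zc z)) = g (b, z) := by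
    have hd : DifferentiableOn ℂ (fun ζ : ℂ => g (b, ζ)) (Metric.closedBall 0 r) := by
      intro ζ hζ
      have h1 : AnalyticAt ℂ g (b, ζ) := by
        refine hp.analyticOnNhd _ ?_
        rw [Metric.mem_eball, edist_zero_right, enorm_lt_coe]
        change ‖((b, ζ) : B × ℂ)‖ < ρ
        rw [Prod.norm_def, max_lt_iff]
        exact ⟨by simpa using hbρ, by
          have : ‖ζ‖ ≤ r := by simpa using hζ
          exact this.trans_lt hrρ⟩
      have h2 : DifferentiableAt ℂ (fun ζ : ℂ => g (b, ζ)) ζ :=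
        h1.differentiableAt.comp ζ (by fun_prop : DifferentiableAt ℂ (fun ζ : ℂ => (b, ζ)) ζ)
      exact h2.differentiableWithinAt
    have h1 := hd.circleIntegral_sub_inv_smul hzr
    rw [cauchyFunctional_apply hr _ (fun ζ => (ζ - z)⁻¹ • g (b, ζ)), h1, smul_smul,
      inv_mul_cancel₀ Complex.two_pi_I_ne_zero, one_smul]
    intro k
    have h2 : zc z k * Ring.inverse (zc z) k = 1 := by
      rw [← ContinuousMap.mul_apply, Ring.mul_inverse_cancel _ hzu, ContinuousMap.one_apply]
    have h3 : zc z k = k - z := by simp [zc, inc]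
    rw [h3] at h2
    rw [ContinuousMap.mul_apply, h𝒢 _ hbn, hφ, smul_eq_mul, eq_inv_of_mul_eq_one_right h2, mul_comm]
  have halg : zc z * ∑ i : Fin d, z ^ (i : ℕ) • rc i c =
      pc c - (monicPoly d c).eval z • 1 := by
    have h1 := sub_mul_sum_divided_difference (fun k => algebraMap ℂ C(K, ℂ) (cf c k)) d inc
      (algebraMap ℂ C(K, ℂ) z)
    have h2 : ∀ x : ℂ, (monicPoly d c).eval x =
        ∑ k ∈ Finset.range (d + 1), cf c k * x ^ k := fun x => by
      rw [eval_eq_sum_range, natDegree_monicPoly]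
    have h3 : zc z = inc - algebraMap ℂ C(K, ℂ) z := by
      rw [Algebra.algebraMap_eq_smul_one]
    have h4 : pc c = ∑ k ∈ Finset.range (d + 1), algebraMap ℂ C(K, ℂ) (cf c k) * inc ^ k := by
      ext k
      rw [hpc, h2, ContinuousMap.sum_apply]
      simp [inc]
    have h5 : (monicPoly d c).eval z • (1 : C(K, ℂ)) = ∑ k ∈ Finset.range (d + 1),
        algebraMap ℂ C(K, ℂ) (cf c k) * algebraMap ℂ C(K, ℂ) z ^ k := by
      rw [← Algebra.algebraMap_eq_smul_one, h2, map_sum]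
      simp only [map_mul, map_pow]
    rw [h3, h4, h5, ← h1]
    congr 1
  have hsum : ∑ i, R i (b, c) * z ^ (i : ℕ) =
      I (𝒢 (φ b) * Ring.inverse (pc c) * ∑ i : Fin d, z ^ (i : ℕ) • rc i c) := by
    rw [Finset.mul_sum, map_sum]
    refine Finset.sum_congr rfl fun i _ => ?_
    rw [mul_smul_comm, map_smul, smul_eq_mul, mul_comm]
  have hq : q ((b, c), z) * (monicPoly d c).eval z =
      I (𝒢 (φ b) * Ring.inverse (pc c) * Ring.inverse (zc z) *
        ((monicPoly d c).eval z • 1)) := by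
    rw [mul_smul_comm, mul_one, map_smul, smul_eq_mul, mul_comm]
  have hz1 := Ring.mul_inverse_cancel _ hzu
  have hp1 := Ring.mul_inverse_cancel _ hcu
  rw [← hcauchy, hsum, hq, ← map_add]
  congr 1
  set S := ∑ i : Fin d, z ^ (i : ℕ) • rc i c
  -- Since `p_c(z) / (ζ - z) + S = p_c(ζ) / (ζ - z)`, the integrands of quotient and remainder add
  -- up to the Cauchy integrand `g(b, ζ) / (ζ - z)`.
  have h6 : (monicPoly d c).eval z • (1 : C(K, ℂ)) = pc c - zc z * S := by
    rw [halg]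
    abel
  rw [h6]
  linear_combination (-(𝒢 (φ b) * Ring.inverse (zc z))) * hp1 +
    (𝒢 (φ b) * Ring.inverse (pc c) * S) * hz1

end Division

/-! ### The preparation theorem from generic division and the implicit function theorem. -/

section Preparation
variable {B : Type*} [NormedAddCommGroup B] [NormedSpace ℂ B]

lemma taylorSeries_sum_mul_pow {d : ℕ} (c : Fin d → ℂ) (j : Fin d) :
    PowerSeries.coeff (j : ℕ) (taylorSeries fun z => ∑ i : Fin d, c i * z ^ (i : ℕ)) = c j := by
  rw [taylorSeries_sum _ fun i _ => by fun_prop, map_sum, Finset.sum_eq_single j]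
  · rw [taylorSeries_mul analyticAt_const (by fun_prop), taylorSeries_const, taylorSeries_pow]
    simp
  · intro i _ hi
    rw [taylorSeries_mul analyticAt_const (by fun_prop), taylorSeries_const, taylorSeries_pow,
      PowerSeries.coeff_C_mul, PowerSeries.coeff_X_pow, if_neg fun h => hi (Fin.ext h.symm),
      mul_zero]
  · simp

/-- The Weierstrass preparation theorem with parameters in a Banach space. -/
theorem exists_hasWeierstrass [CompleteSpace B] {g : B × ℂ → ℂ} (hg : AnalyticAt ℂ g 0) {d : ℕ}
    (hlow : ∀ j < d, iteratedDeriv j (fun z => g (0, z)) 0 = 0)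
    (hd : iteratedDeriv d (fun z => g (0, z)) 0 ≠ 0) : ∃ a, HasWeierstrass g d a := by
  obtain ⟨q, R, hq, hR, hqR⟩ := exists_generic_division hg d
  have hz : Tendsto (fun z : ℂ => (((0, 0), z) : (B × (Fin d → ℂ)) × ℂ)) (𝓝 0) (𝓝 0) :=
    (by fun_prop : Continuous fun z : ℂ => (((0, 0), z) : (B × (Fin d → ℂ)) × ℂ)).tendsto' 0 0 rfl
  set q₀ : ℂ → ℂ := fun z => q ((0, 0), z) with hq₀def
  have hq₀ : AnalyticAt ℂ q₀ 0 := AnalyticAt.fun_comp_of_eq (g := q)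
    (f := fun z : ℂ => (((0, 0), z) : (B × (Fin d → ℂ)) × ℂ)) hq (by fun_prop) rfl
  have hsumAn : ∀ c : Fin d → ℂ, AnalyticAt ℂ (fun z : ℂ => ∑ i, c i * z ^ (i : ℕ)) 0 :=
    fun c => Finset.analyticAt_fun_sum _ fun i _ => by fun_prop
  have hT : taylorSeries (fun z => g (0, z)) = taylorSeries q₀ * PowerSeries.X ^ d +
      taylorSeries (fun z => ∑ i, R i 0 * z ^ (i : ℕ)) := by
    rw [← taylorSeries_pow, ← taylorSeries_mul hq₀ (by fun_prop),
      ← taylorSeries_add (hq₀.fun_mul (by fun_prop)) (hsumAn _)]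
    refine taylorSeries_congr ?_
    filter_upwards [hz.eventually hqR] with z hz
    simpa [monicPoly_zero] using! hz
  -- At `b = 0`, `c = 0` the divisor is `z ^ d`, which divides `g(0, z)`; the remainder vanishes and
  -- the quotient is a unit.
  have hR0 : ∀ i, R i 0 = 0 := fun i => by
    have h1 := (coeff_taylorSeries_eq_zero_iff _ _).2 (hlow i i.2)
    rwa [hT, map_add, PowerSeries.coeff_mul_X_pow', if_neg (by omega), zero_add,
      taylorSeries_sum_mul_pow] at h1
  have hq0 : q₀ 0 ≠ 0 := by
    rw [Ne, ← coeff_taylorSeries_eq_zero_iff, hT] at hd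
    simpa [hR0, taylorSeries_const, coeff_taylorSeries, PowerSeries.coeff_mul_X_pow'] using hd
  set F : B × (Fin d → ℂ) → (Fin d → ℂ) := fun w i => R i w with hF
  have hFa : AnalyticAt ℂ F 0 := by
    rw [analyticAt_pi_iff]
    exact hR
  have hFc : ContDiffAt ℂ ⊤ F (0, 0) := hFa.contDiffAt
  set T : (Fin d → ℂ) →L[ℂ] (Fin d → ℂ) :=
    fderiv ℂ F (0, 0) ∘L ContinuousLinearMap.inr ℂ B (Fin d → ℂ) with hTdef
  -- The Weierstrass coefficients solve `R(b, a(b)) = 0`; it remains to see that the derivative of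
  -- the remainder in `c` is invertible, for which injectivity suffices.
  have hinj : Function.Injective T := by
    rw [injective_iff_map_eq_zero]
    intro μ hμ
    set G : ℂ × ℂ → ℂ := fun w => q ((0, w.1 • μ), w.2) with hGdef
    have hG : AnalyticAt ℂ G 0 := AnalyticAt.fun_comp_of_eq (g := q)
      (f := fun w : ℂ × ℂ => (((0, w.1 • μ), w.2) : (B × (Fin d → ℂ)) × ℂ)) hq (by fun_prop)
      (by simp)
    have hline : Tendsto (fun w : ℂ × ℂ => (((0, w.1 • μ), w.2) : (B × (Fin d → ℂ)) × ℂ))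
        (𝓝 0) (𝓝 0) := (by fun_prop : Continuous
          fun w : ℂ × ℂ => (((0, w.1 • μ), w.2) : (B × (Fin d → ℂ)) × ℂ)).tendsto' 0 0 (by simp)
    have hRd : HasDerivAt (fun ε : ℂ => F (0, ε • μ)) 0 0 := by
      have h1 : HasDerivAt (fun ε : ℂ => ((0, ε • μ) : B × (Fin d → ℂ))) (0, μ) 0 := by
        have := (hasDerivAt_id (0 : ℂ)).smul_const μ
        exact (hasDerivAt_const (0 : ℂ) (0 : B)).prodMk (by simpa using this)
      have h2 : HasFDerivAt F (fderiv ℂ F (0, 0)) ((0, (0 : ℂ) • μ) : B × (Fin d → ℂ)) := by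
        rw [zero_smul]
        exact hFa.differentiableAt.hasFDerivAt
      have h3 := h2.comp_hasDerivAt (0 : ℂ) h1
      have h4 : fderiv ℂ F (0, 0) (0, μ) = 0 := hμ
      rwa [h4] at h3
    have hRi : ∀ i, HasDerivAt (fun ε : ℂ => R i (0, ε • μ)) 0 0 := fun i =>
      hasDerivAt_pi.1 hRd i
    -- Differentiate the division identity at `c = ε μ` with respect to `ε` at `0`; the left side
    -- does not depend on `ε`, and the remainder has zero derivative because `T μ = 0`.
    have key : ∀ᶠ z in 𝓝 (0 : ℂ), derivFst G (0, z) * z ^ d +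
        q₀ z * ∑ i, μ i * z ^ (i : ℕ) = 0 := by
      have hsw : Tendsto (fun z : ℂ => ((0, z) : ℂ × ℂ)) (𝓝 0) (𝓝 0) :=
        (by fun_prop : Continuous fun z : ℂ => ((0, z) : ℂ × ℂ)).tendsto' 0 0 rfl
      filter_upwards [hsw.eventually (hline.eventually hqR).eventually_nhds,
        hsw.eventually hG.eventually_analyticAt] with z hz1 hz2
      have h1 : ∀ᶠ ε in 𝓝 (0 : ℂ), g (0, z) = G (ε, z) * (z ^ d + ε * ∑ i, μ i * z ^ (i : ℕ)) +
          ∑ i, R i (0, ε • μ) * z ^ (i : ℕ) := by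
        have h2 : Tendsto (fun ε : ℂ => ((ε, z) : ℂ × ℂ)) (𝓝 0) (𝓝 (0, z)) :=
          (by fun_prop : Continuous fun ε : ℂ => ((ε, z) : ℂ × ℂ)).tendsto' 0 _ rfl
        filter_upwards [h2.eventually hz1] with ε hε
        rw [hε]
        simp [monicPoly, eval_finsetSum, Finset.mul_sum, mul_assoc, hGdef]
      have h3 : HasDerivAt (fun ε => G (ε, z)) (derivFst G (0, z)) 0 := by
        rw [← deriv_fst_eq hz2]
        have h1 : HasDerivAt (fun w : ℂ => ((w, z) : ℂ × ℂ)) (1, 0) 0 :=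
          (hasDerivAt_id _).prodMk (hasDerivAt_const _ z)
        exact (hz2.differentiableAt.hasFDerivAt.comp_hasDerivAt 0 h1).differentiableAt.hasDerivAt
      have h4 : HasDerivAt (fun ε : ℂ => z ^ d + ε * ∑ i, μ i * z ^ (i : ℕ))
          (∑ i, μ i * z ^ (i : ℕ)) 0 := by
        simpa using ((hasDerivAt_id (0 : ℂ)).mul_const (∑ i, μ i * z ^ (i : ℕ))).const_add (z ^ d)
      have h5 : HasDerivAt (fun ε : ℂ => ∑ i, R i (0, ε • μ) * z ^ (i : ℕ)) 0 0 := by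
        have := HasDerivAt.fun_sum (u := Finset.univ)
          fun i (_ : i ∈ Finset.univ) => (hRi i).mul_const (z ^ (i : ℕ))
        simpa using this
      have h6 := (h3.mul h4).add h5
      have h7 : HasDerivAt (fun _ : ℂ => g (0, z)) 0 (0 : ℂ) := hasDerivAt_const _ _
      have h8 := h6.unique (h7.congr_of_eventuallyEq (h1.mono fun ε hε => hε.symm))
      simpa [hGdef, hq₀def] using h8
    have hGz : AnalyticAt ℂ (fun z => derivFst G (0, z)) 0 :=
      AnalyticAt.fun_comp_of_eq (g := derivFst G) (f := fun z : ℂ => ((0, z) : ℂ × ℂ))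
        (analyticAt_derivFst hG) (by fun_prop) rfl
    have hser : taylorSeries (fun z => derivFst G (0, z)) * PowerSeries.X ^ d +
        taylorSeries q₀ * taylorSeries (fun z => ∑ i, μ i * z ^ (i : ℕ)) = 0 := by
      rw [← taylorSeries_pow, ← taylorSeries_mul hGz (by fun_prop),
        ← taylorSeries_mul hq₀ (hsumAn _),
        ← taylorSeries_add (hGz.fun_mul (by fun_prop)) (hq₀.fun_mul (hsumAn _)),
        taylorSeries_congr key, taylorSeries_const, map_zero]
    have hunit : IsUnit (taylorSeries q₀) := by
      rw [PowerSeries.isUnit_iff_constantCoeff, isUnit_iff_ne_zero,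
        ← PowerSeries.coeff_zero_eq_constantCoeff_apply]
      simpa only [coeff_taylorSeries, iteratedDeriv_zero, Nat.factorial_zero, Nat.cast_one,
        div_one] using hq0
    -- A polynomial of degree `< d` divisible by `z ^ d` is zero, so `μ = 0`.
    have hdvd : PowerSeries.X ^ d ∣ taylorSeries (fun z => ∑ i, μ i * z ^ (i : ℕ)) := by
      rw [← hunit.dvd_mul_left, eq_neg_of_add_eq_zero_right hser]
      exact (dvd_mul_left _ _).neg_right
    funext i
    have := PowerSeries.X_pow_dvd_iff.1 hdvd i i.2
    rwa [taylorSeries_sum_mul_pow] at this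
  have hinv : T.IsInvertible := by
    refine ⟨(LinearEquiv.ofInjectiveEndo T.toLinearMap hinj).toContinuousLinearEquiv, ?_⟩
    ext1 μ
    rfl
  have hF0 : F (0, 0) = 0 := funext hR0
  set a : B → Fin d → ℂ := hFc.implicitFunction (by simp) hinv with ha
  have haA : AnalyticAt ℂ a 0 := (hFc.contDiffAt_implicitFunction (by simp) hinv).analyticAt
  have ha0 : a 0 = 0 := hFc.implicitFunction_apply_self (by simp) hinv
  have haF : ∀ᶠ b in 𝓝 (0 : B), F (b, a b) = 0 := by
    have := hFc.eventually_apply_implicitFunction (by simp) hinv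
    rwa [hF0] at this
  have hemb : AnalyticAt ℂ (fun w : B × ℂ => (((w.1, a w.1), w.2) : (B × (Fin d → ℂ)) × ℂ)) 0 := by
    have : AnalyticAt ℂ (fun w : B × ℂ => a w.1) 0 :=
      AnalyticAt.fun_comp_of_eq (g := a) (f := fun w : B × ℂ => w.1) haA (by fun_prop) rfl
    exact (AnalyticAt.prod (by fun_prop) this).prod (by fun_prop)
  have hemb0 : (((0 : B × ℂ).1, a (0 : B × ℂ).1), (0 : B × ℂ).2) =
      (0 : (B × (Fin d → ℂ)) × ℂ) := by simp [ha0]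
  have htend : Tendsto (fun w : B × ℂ => (((w.1, a w.1), w.2) : (B × (Fin d → ℂ)) × ℂ))
      (𝓝 0) (𝓝 0) := by
    have := hemb.continuousAt.tendsto
    rwa [hemb0] at this
  have hfst : Tendsto (fun w : B × ℂ => w.1) (𝓝 0) (𝓝 0) :=
    continuous_fst.tendsto' 0 0 rfl
  refine ⟨a, fun i => (analyticAt_pi_iff.1 haA) i, ha0, fun w => q ((w.1, a w.1), w.2),
    AnalyticAt.fun_comp_of_eq (g := q) hq hemb hemb0, ?_, ?_⟩
  · change q ((0, a 0), 0) ≠ 0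
    rwa [ha0]
  · filter_upwards [htend.eventually hqR, hfst.eventually haF] with w hw hw'
    have : ∀ i, R i (w.1, a w.1) = 0 := fun i => congrFun hw' i
    simpa [this] using hw

end Preparation

/-! ### Multiplicities and tangent cones. -/

section Mult
variable {E : Type*} [NormedAddCommGroup E] [NormedSpace ℂ E]

/-- The term of order `k` of the expansion vanishes on the diagonal, so replacing it by `0` still
gives an expansion of `g`; the derivative is the symmetrization of this term. -/
lemma iteratedFDeriv_eq_zero_of_diag {g : E → ℂ} {x : E} (hg : AnalyticAt ℂ g x) {k : ℕ}
    (h : ∀ v, iteratedFDeriv ℂ k g x (fun _ => v) = 0) : iteratedFDeriv ℂ k g x = 0 := by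
  obtain ⟨p, r, hp⟩ := hg
  have hpk : ∀ v, p k (fun _ => v) = 0 := fun v => by
    have h1 := hp.factorial_smul v k
    rw [h v] at h1
    exact (smul_eq_zero.1 h1).resolve_left k.factorial_ne_zero
  let p' : FormalMultilinearSeries ℂ E ℂ := fun n => if n = k then 0 else p n
  have hp' : HasFPowerSeriesOnBall g p' x r := by
    refine ⟨hp.r_le.trans (ENNReal.le_of_forall_nnreal_lt fun s hs => ?_), hp.r_pos, fun hy => ?_⟩
    · obtain ⟨C, hC0, hC⟩ := p.norm_mul_pow_le_of_lt_radius hs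
      refine p'.le_radius_of_bound C fun n => ?_
      by_cases hn : n = k
      · simp [p', hn, hC0.le]
      · simpa [p', hn] using hC n
    · convert hp.hasSum hy using 1
      funext n
      by_cases hn : n = k
      · subst hn
        simp [p', hpk]
      · simp [p', hn]
  ext v
  rw [hp'.iteratedFDeriv_eq_sum_of_completeSpace]
  simp [p']

lemma iteratedDeriv_add_smul_line {g : E → ℂ} {x : E} (hg : AnalyticAt ℂ g x) (v : E) (k : ℕ) :
    iteratedDeriv k (fun s : ℂ => g (x + s • v)) 0 = iteratedFDeriv ℂ k g x (fun _ => v) := by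
  have h1 : AnalyticAt ℂ (fun y => g (x + y)) 0 :=
    AnalyticAt.fun_comp_of_eq (g := g) (f := fun y => x + y) hg (by fun_prop) (by simp)
  have h2 := iteratedDeriv_smul_line h1 v k
  rwa [iteratedFDeriv_comp_add_left, add_zero] at h2

lemma analyticAt_iteratedFDeriv {g : E → ℂ} {x : E} (hg : AnalyticAt ℂ g x) (k : ℕ) :
    AnalyticAt ℂ (iteratedFDeriv ℂ k g) x := by
  have h : AnalyticOnNhd ℂ g {y | AnalyticAt ℂ g y} := fun y hy => hy
  exact h.iteratedFDeriv k x hg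

lemma mult_eq_of {g : E → ℂ} {x : E} {m : ℕ} (hlow : ∀ k < m, iteratedFDeriv ℂ k g x = 0)
    (hm : iteratedFDeriv ℂ m g x ≠ 0) : mult g x = m := by
  refine le_antisymm (iInf₂_le m hm) (le_iInf₂ fun k hk => ?_)
  by_contra hkm
  exact hk (hlow k (by simpa using hkm))

lemma iteratedFDeriv_eq_zero_of_lt_mult {g : E → ℂ} {x : E} {k : ℕ} (h : (k : ℕ∞) < mult g x) :
    iteratedFDeriv ℂ k g x = 0 := by
  by_contra hk
  exact not_le_of_gt h (iInf₂_le k hk)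

lemma exists_mult_eq {g : E → ℂ} (hg : AnalyticAt ℂ g 0) (hne : ¬ ∀ᶠ q in 𝓝 (0 : E), g q = 0) :
    ∃ m : ℕ, mult g 0 = m ∧ iteratedFDeriv ℂ m g 0 ≠ 0 := by
  have h1 : ∃ m, iteratedFDeriv ℂ m g 0 ≠ 0 := by
    by_contra! h
    refine hne (eventually_eq_zero_of_lines hg fun v k => ?_)
    rw [iteratedDeriv_smul_line hg, h]
    rfl
  classical
  refine ⟨Nat.find h1, mult_eq_of (fun k hk => ?_) (Nat.find_spec h1), Nat.find_spec h1⟩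
  by_contra hk'
  exact Nat.find_min h1 hk hk'

/-- A direction along which, and near which, the order of vanishing equals the multiplicity is
transverse to the tangent cone. -/
lemma notMem_tangentConeZero {g : E → ℂ} (hg : AnalyticAt ℂ g 0) {v : E} {m : ℕ}
    (hlow : ∀ᶠ w in 𝓝 v, ∀ k < m, iteratedDeriv k (fun s : ℂ => g (s • w)) 0 = 0)
    (hm : iteratedDeriv m (fun s : ℂ => g (s • v)) 0 ≠ 0) : v ∉ tangentConeZero g := by
  -- A homogeneous form vanishing near `v` vanishes everywhere, so the multiplicity is not below
  -- `m`.
  have hlow' : ∀ k < m, iteratedFDeriv ℂ k g 0 = 0 := fun k hk => by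
    refine iteratedFDeriv_eq_zero_of_diag hg fun w => ?_
    have han : AnalyticOnNhd ℂ (fun w : E => iteratedFDeriv ℂ k g 0 (fun _ => w)) Set.univ :=
      fun w _ => (((iteratedFDeriv ℂ k g 0).contDiff (n := ⊤)).contDiffAt.comp w
        (contDiff_pi.2 fun _ => contDiff_id).contDiffAt).analyticAt
    have h0 : (fun w : E => iteratedFDeriv ℂ k g 0 (fun _ => w)) =ᶠ[𝓝 v] fun _ => 0 := by
      filter_upwards [hlow] with w hw
      rw [← iteratedDeriv_smul_line hg, hw k hk]
    exact congrFun (han.eq_of_eventuallyEq (fun _ _ => analyticAt_const) h0) w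
  rw [iteratedDeriv_smul_line hg] at hm
  have hm' : iteratedFDeriv ℂ m g 0 ≠ 0 := fun h => hm (by rw [h]; rfl)
  exact fun h => hm (h m (mult_eq_of hlow' hm'))

end Mult

/-! ### Equimultiplicity along `x = 0` as a uniform order in `x`. -/

section XOrder
lemma tendsto_zero_prodMk {P : Type*} [NormedAddCommGroup P] :
    Tendsto (fun t : P => ((0, t) : ℂ × P)) (𝓝 0) (𝓝 0) :=
  (by fun_prop : Continuous fun t : P => ((0, t) : ℂ × P)).tendsto' 0 0 rfl

variable {P : Type*} [NormedAddCommGroup P] [NormedSpace ℂ P]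

/-- `E(x, t)` vanishes along `x = 0` to order exactly `M`, uniformly near the origin. -/
def IsXOrder (E : ℂ × P → ℂ) (M : ℕ) : Prop :=
  (∀ᶠ t in 𝓝 (0 : P), ∀ j < M, iteratedDeriv j (fun x => E (x, t)) 0 = 0) ∧
    iteratedDeriv M (fun x => E (x, 0)) 0 ≠ 0

lemma iteratedDeriv_fst_eq {E : ℂ × P → ℂ} {t : P} (hE : AnalyticAt ℂ E (0, t)) (k : ℕ) :
    iteratedDeriv k (fun x => E (x, t)) 0 = iteratedFDeriv ℂ k E (0, t) (fun _ => (1, 0)) := by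
  rw [← iteratedDeriv_add_smul_line hE]
  simp

/-- If the `k`-th derivative vanishes along `x = 0`, differentiating it in a direction tangent to `x
= 0` gives zero; by symmetry this holds in every slot, so only the components along the `x`-axis
survive. -/
lemma iteratedFDeriv_succ_eq_prod_smul {E : ℂ × P → ℂ} {t : P} (hE : AnalyticAt ℂ E (0, t)) {k : ℕ}
    (h : ∀ᶠ s in 𝓝 t, iteratedFDeriv ℂ k E (0, s) = 0) (v : Fin (k + 1) → ℂ × P) :
    iteratedFDeriv ℂ (k + 1) E (0, t) v =
      (∏ i, (v i).1) • iteratedFDeriv ℂ (k + 1) E (0, t) (fun _ => (1, 0)) := by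
  set T := iteratedFDeriv ℂ (k + 1) E (0, t) with hT
  have hz0 : ∀ m : Fin (k + 1) → ℂ × P, (m 0).1 = 0 → T m = 0 := fun m hm => by
    have h1 : HasDerivAt (fun s : ℂ => ((0, t + s • (m 0).2) : ℂ × P)) (m 0) 0 := by
      have := (hasDerivAt_const (0 : ℂ) (0 : ℂ)).prodMk
        (((hasDerivAt_id (0 : ℂ)).smul_const (m 0).2).const_add t)
      have hm' : m 0 = (0, (1 : ℂ) • (m 0).2) := by rw [one_smul, ← hm]
      rw [hm']
      simpa using this
    have h2 : HasFDerivAt (iteratedFDeriv ℂ k E) (fderiv ℂ (iteratedFDeriv ℂ k E) (0, t))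
        ((0, t + (0 : ℂ) • (m 0).2) : ℂ × P) := by
      rw [zero_smul, add_zero]
      exact (analyticAt_iteratedFDeriv hE k).differentiableAt.hasFDerivAt
    have h3 := h2.comp_hasDerivAt (0 : ℂ) h1
    have h4 : Tendsto (fun s : ℂ => t + s • (m 0).2) (𝓝 0) (𝓝 t) :=
      (by fun_prop : Continuous fun s : ℂ => t + s • (m 0).2).tendsto' 0 t (by simp)
    have h5 : (iteratedFDeriv ℂ k E ∘ fun s : ℂ => ((0, t + s • (m 0).2) : ℂ × P)) =ᶠ[𝓝 0]
        fun _ => 0 := h4.eventually h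
    have h6 := h3.unique ((hasDerivAt_const (0 : ℂ) _).congr_of_eventuallyEq h5)
    rw [hT, iteratedFDeriv_succ_apply_left, h6]
    rfl
  have hz : ∀ m : Fin (k + 1) → ℂ × P, ∀ i, (m i).1 = 0 → T m = 0 := fun m i hm => by
    rw [hT, ← ContDiffAt.iteratedFDeriv_comp_perm hE.contDiffAt m (Equiv.swap 0 i)]
    exact hz0 _ (by simpa using hm)
  have hv : v = (fun i => (v i).1 • ((1, 0) : ℂ × P)) + fun i => (0, (v i).2) := by
    funext i
    ext <;> simp
  rw [← ContinuousMultilinearMap.map_smul_univ]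
  conv_lhs => rw [hv]
  rw [ContinuousMultilinearMap.map_add_univ, Finset.sum_eq_single Finset.univ]
  · simp
  · intro s _ hs
    obtain ⟨i, hi⟩ : ∃ i, i ∉ s := by
      by_contra! h
      exact hs (Finset.eq_univ_iff_forall.2 h)
    exact hz _ i (by simp [Finset.piecewise, hi])
  · simp

/-- With constant multiplicity `M` all derivatives of order `< M` vanish along `x = 0`; the initial
form is then a multiple of `x ^ M`, so its value on the `x`-axis is nonzero. -/
lemma exists_isXOrder_of_mult_eq {E : ℂ × P → ℂ} (hE : AnalyticAt ℂ E 0)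
    (hne : ¬ ∀ᶠ q in 𝓝 (0 : ℂ × P), E q = 0)
    (h : ∀ᶠ t in 𝓝 (0 : P), mult E (0, t) = mult E 0) : ∃ M, IsXOrder E M := by
  obtain ⟨M, hM, hM0⟩ := exists_mult_eq hE hne
  have hlow : ∀ᶠ t in 𝓝 (0 : P), ∀ j < M, iteratedFDeriv ℂ j E (0, t) = 0 := by
    filter_upwards [h] with t ht j hj
    refine iteratedFDeriv_eq_zero_of_lt_mult ?_
    rw [ht, hM]
    exact_mod_cast hj
  refine ⟨M, ?_, ?_⟩
  · filter_upwards [hlow, tendsto_zero_prodMk.eventually hE.eventually_analyticAt] with t ht ht' j hj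
    rw [iteratedDeriv_fst_eq ht', ht j hj]
    rfl
  · rw [iteratedDeriv_fst_eq hE]
    intro h0
    apply hM0
    cases M with
    | zero =>
      ext v
      rw [Subsingleton.elim v fun _ => (1, 0)]
      exact h0
    | succ k =>
      ext v
      rw [show (0 : ℂ × P) = (0, 0) from rfl,
        iteratedFDeriv_succ_eq_prod_smul hE (hlow.mono fun s hs => hs k (Nat.lt_succ_self k)), h0,
        smul_zero]
      rfl

/-- By induction on the order: once the derivatives of order `< k` vanish along `x = 0`, those of
order `k` are determined by the pure `x`-derivative, which is zero for `k < M`. Nonvanishing in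
order `M` is an open condition. -/
lemma IsXOrder.mult_eq {E : ℂ × P → ℂ} (hE : AnalyticAt ℂ E 0) {M : ℕ} (h : IsXOrder E M) :
    ∀ᶠ t in 𝓝 (0 : P), mult E (0, t) = mult E 0 := by
  have hlow : ∀ k ≤ M, ∀ᶠ t in 𝓝 (0 : P), ∀ j < k, iteratedFDeriv ℂ j E (0, t) = 0 := by
    intro k
    induction k with
    | zero => simp
    | succ k ih =>
      intro hk
      filter_upwards [(ih (by omega)).eventually_nhds, h.1,
        tendsto_zero_prodMk.eventually hE.eventually_analyticAt] with t ht ht1 ht2 j hj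
      rcases (Nat.lt_succ_iff_lt_or_eq.1 hj) with hj | rfl
      · exact ht.self_of_nhds j hj
      · have h1 := ht1 j (by omega)
        rw [iteratedDeriv_fst_eq ht2] at h1
        cases j with
        | zero =>
          ext v
          rw [Subsingleton.elim v fun _ => (1, 0)]
          exact h1
        | succ j =>
          ext v
          rw [iteratedFDeriv_succ_eq_prod_smul ht2 (ht.mono fun s hs => hs j (by omega)), h1,
            smul_zero]
          rfl
  have hM : ∀ᶠ t in 𝓝 (0 : P), iteratedFDeriv ℂ M E (0, t) ≠ 0 := by
    have h1 := h.2
    rw [iteratedDeriv_fst_eq hE] at h1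
    have h2 : iteratedFDeriv ℂ M E 0 ≠ 0 := fun h' => h1 (by
      rw [show ((0, 0) : ℂ × P) = 0 from rfl, h']
      rfl)
    exact tendsto_zero_prodMk.eventually
      ((analyticAt_iteratedFDeriv hE M).continuousAt.eventually_ne h2)
  have hall : ∀ᶠ t in 𝓝 (0 : P), mult E (0, t) = M := by
    filter_upwards [hlow M le_rfl, hM] with t ht ht' using mult_eq_of ht ht'
  filter_upwards [hall] with t ht
  rw [ht]
  exact hall.self_of_nhds.symm

end XOrder

/-! ### Regular functions on principal open subsets of `GL₃(ℂ)`. -/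

section Regular

/-- The value at a matrix of a polynomial in the entries of a `3 × 3` matrix. -/
def evalMatrix (p : MvPolynomial (Fin 3 × Fin 3) ℂ) (A : Matrix (Fin 3) (Fin 3) ℂ) : ℂ :=
  MvPolynomial.eval (fun ij => A ij.1 ij.2) p

lemma evalMatrix_mul (p q : MvPolynomial (Fin 3 × Fin 3) ℂ) (A : Matrix (Fin 3) (Fin 3) ℂ) :
    evalMatrix (p * q) A = evalMatrix p A * evalMatrix q A := map_mul _ _ _

/-- The principal open subset of `GL₃(ℂ)` where the polynomial `h` does not vanish. -/
abbrev Locus (h : MvPolynomial (Fin 3 × Fin 3) ℂ) : Type :=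
  {A : Matrix.GeneralLinearGroup (Fin 3) ℂ // evalMatrix h (A : Matrix (Fin 3) (Fin 3) ℂ) ≠ 0}

/-- The algebra of rational functions in the matrix entries whose denominator is a power
of `h`. -/
def regularFunctions (h : MvPolynomial (Fin 3 × Fin 3) ℂ) : Subalgebra ℂ (Locus h → ℂ) where
  carrier := {φ | ∃ (N : ℕ) (p : MvPolynomial (Fin 3 × Fin 3) ℂ), ∀ A : Locus h,
    φ A * evalMatrix h A.1 ^ N = evalMatrix p A.1}
  mul_mem' := by
    rintro φ ψ ⟨N, p, hp⟩ ⟨N', p', hp'⟩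
    refine ⟨N + N', p * p', fun A => ?_⟩
    rw [evalMatrix_mul, ← hp, ← hp', Pi.mul_apply]
    ring
  add_mem' := by
    rintro φ ψ ⟨N, p, hp⟩ ⟨N', p', hp'⟩
    refine ⟨N + N', p * h ^ N' + p' * h ^ N, fun A => ?_⟩
    have h1 := hp A
    have h2 := hp' A
    simp only [evalMatrix, map_add, map_mul, map_pow] at h1 h2 ⊢
    rw [← h1, ← h2, Pi.add_apply]
    ring
  algebraMap_mem' := fun c => ⟨0, MvPolynomial.C c, fun A => by simp [evalMatrix]⟩

lemma mem_regularFunctions_of_eq {h : MvPolynomial (Fin 3 × Fin 3) ℂ} {φ : Locus h → ℂ}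
    (p : MvPolynomial (Fin 3 × Fin 3) ℂ) (hp : ∀ A : Locus h, φ A = evalMatrix p A.1) :
    φ ∈ regularFunctions h := ⟨0, p, fun A => by rw [pow_zero, mul_one, hp]⟩

/-- The inclusion of a smaller principal open subset. -/
def Locus.incl {h p : MvPolynomial (Fin 3 × Fin 3) ℂ} (A : Locus (h * p)) : Locus h :=
  ⟨A.1, fun h0 => A.2 (by rw [evalMatrix_mul, h0, zero_mul])⟩

lemma Locus.right_ne_zero {h p : MvPolynomial (Fin 3 × Fin 3) ℂ} (A : Locus (h * p)) :
    evalMatrix p A.1 ≠ 0 := fun h0 => A.2 (by rw [evalMatrix_mul, h0, mul_zero])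

lemma comp_incl_mem_regularFunctions {h : MvPolynomial (Fin 3 × Fin 3) ℂ} {φ : Locus h → ℂ}
    (hφ : φ ∈ regularFunctions h) (p : MvPolynomial (Fin 3 × Fin 3) ℂ) :
    (fun A : Locus (h * p) => φ A.incl) ∈ regularFunctions (h * p) := by
  obtain ⟨N, q, hq⟩ := hφ
  refine ⟨N, q * p ^ N, fun A => ?_⟩
  have h1 : φ A.incl * evalMatrix h A.1 ^ N = evalMatrix q A.1 := hq A.incl
  rw [evalMatrix_mul, evalMatrix_mul, ← h1]
  simp only [evalMatrix, map_pow]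
  ring

lemma inv_mem_regularFunctions {h p : MvPolynomial (Fin 3 × Fin 3) ℂ} {φ : Locus (h * p) → ℂ}
    {N : ℕ} (hφ : ∀ A, φ A * evalMatrix h A.1 ^ N = evalMatrix p A.1) :
    (fun A => (φ A)⁻¹) ∈ regularFunctions (h * p) := by
  -- From `φ = p / h ^ N` one gets `1 / φ = h ^ (N + 1) / (h * p)`.
  refine ⟨1, h ^ (N + 1), fun A => ?_⟩
  have h1 : evalMatrix h A.1 ≠ 0 := A.incl.2
  have h2 : φ A ≠ 0 := fun h0 => A.right_ne_zero (by rw [← hφ, h0, zero_mul])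
  rw [pow_one, evalMatrix_mul, ← hφ]
  simp only [evalMatrix, map_pow] at h1 ⊢
  field_simp
  ring

/-- A polynomial that vanishes on a nonempty principal open subset of `GL₃(ℂ)` is zero. -/
lemma eq_zero_of_evalMatrix_eq_zero {h p : MvPolynomial (Fin 3 × Fin 3) ℂ}
    (hne : Nonempty (Locus h)) (hp : ∀ A : Locus h, evalMatrix p A.1 = 0) : p = 0 := by
  obtain ⟨A₀⟩ := hne
  set D : MvPolynomial (Fin 3 × Fin 3) ℂ :=
    Matrix.det (Matrix.of fun i j => MvPolynomial.X (i, j)) with hD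
  have hDe : ∀ A : Matrix (Fin 3) (Fin 3) ℂ, evalMatrix D A = A.det := fun A => by
    rw [evalMatrix, hD, RingHom.map_det]
    congr 1
    ext i j
    simp
  -- The product vanishes at every matrix, invertible or not, and the polynomial ring is a domain.
  have h1 : p * h * D = 0 := by
    refine MvPolynomial.funext fun x => ?_
    have hx : MvPolynomial.eval x (p * h * D) =
        evalMatrix (p * h * D) (Matrix.of fun i j => x (i, j)) := rfl
    rw [hx, map_zero, evalMatrix_mul, evalMatrix_mul, hDe]
    set A : Matrix (Fin 3) (Fin 3) ℂ := Matrix.of fun i j => x (i, j)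
    by_cases hA : A.det = 0
    · rw [hA, mul_zero]
    by_cases hh : evalMatrix h A = 0
    · rw [hh, mul_zero, zero_mul]
    have hpA := hp ⟨Matrix.GeneralLinearGroup.mkOfDetNeZero A hA, hh⟩
    have hpA' : evalMatrix p A = 0 := hpA
    rw [hpA', zero_mul, zero_mul]
  have h2 : h ≠ 0 := fun h0 => A₀.2 (by simp [h0, evalMatrix])
  have h3 : D ≠ 0 := fun h0 => by
    have h4 : (A₀.1 : Matrix (Fin 3) (Fin 3) ℂ).det ≠ 0 :=
      ((Matrix.isUnit_iff_isUnit_det _).1 A₀.1.isUnit).ne_zero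
    exact h4 (by rw [← hDe, h0]; simp [evalMatrix])
  simpa [h2, h3] using h1

/-- The Taylor coefficients of an analytic germ along the line through `A w` are polynomials in the
entries of `A`. -/
lemma exists_evalMatrix_eq_iteratedDeriv {g : (Fin 3 → ℂ) → ℂ} (hg : AnalyticAt ℂ g 0)
    (w : Fin 3 → ℂ) (k : ℕ) : ∃ p, ∀ A : Matrix (Fin 3) (Fin 3) ℂ,
      iteratedDeriv k (fun s : ℂ => g (s • A.mulVec w)) 0 = evalMatrix p A := by
  refine ⟨∑ r : Fin k → Fin 3, (∏ i, ∑ l, MvPolynomial.C (w l) * MvPolynomial.X (r i, l)) *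
    MvPolynomial.C (iteratedFDeriv ℂ k g 0 fun i => Pi.single (r i) 1), fun A => ?_⟩
  rw [iteratedDeriv_smul_line hg]
  have h1 : (fun _ : Fin k => A.mulVec w) =
      fun _ => ∑ j, A.mulVec w j • (Pi.single j (1 : ℂ) : Fin 3 → ℂ) := by
    funext i
    exact pi_eq_sum_univ' _
  rw [h1, ContinuousMultilinearMap.map_sum, evalMatrix, map_sum]
  refine Finset.sum_congr rfl fun r _ => ?_
  rw [ContinuousMultilinearMap.map_smul_univ, map_mul, map_prod, MvPolynomial.eval_C, smul_eq_mul]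
  congr 1
  refine Finset.prod_congr rfl fun i _ => ?_
  simp [Matrix.mulVec, dotProduct, mul_comm]

/-- Two integer invariants, compared lexicographically and detected by the nonvanishing of regular
functions, are constant on a nonempty principal open subset. -/
lemma exists_locus_const {h : MvPolynomial (Fin 3 × Fin 3) ℂ} (hne : Nonempty (Locus h))
    (i m : Locus h → ℕ) (φ : ℕ → ℕ → Locus h → ℂ) (hφ : ∀ i k, φ i k ∈ regularFunctions h)
    (h1 : ∀ A, φ (i A) (m A) A ≠ 0) (h2 : ∀ A, ∀ k < m A, φ (i A) k A = 0)
    (h3 : ∀ A A', i A' < i A → ∀ k, φ (i A') k A = 0) :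
    ∃ p i₀ m₀ N, Nonempty (Locus (h * p)) ∧ (∀ A : Locus (h * p), i A.incl = i₀ ∧ m A.incl = m₀) ∧
      (∀ A, i₀ ≤ i A) ∧
      ∀ A : Locus (h * p), φ i₀ m₀ A.incl * evalMatrix h A.1 ^ N = evalMatrix p A.1 := by
  obtain ⟨A₁, hA₁⟩ : ∃ A₁, ∀ A, i A₁ ≤ i A := by
    obtain ⟨A₁, hA₁⟩ := Nat.sInf_mem (Set.range_nonempty i)
    exact ⟨A₁, fun A => hA₁ ▸ Nat.sInf_le ⟨A, rfl⟩⟩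
  obtain ⟨A₀, hA₀, hA₀'⟩ : ∃ A₀, i A₀ = i A₁ ∧ ∀ A, i A = i A₁ → m A₀ ≤ m A := by
    set S := m '' {A | i A = i A₁}
    have hS : S.Nonempty := ⟨m A₁, A₁, rfl, rfl⟩
    obtain ⟨A₀, hA₀, hm⟩ := Nat.sInf_mem hS
    exact ⟨A₀, hA₀, fun A hA => hm ▸ Nat.sInf_le ⟨A, hA, rfl⟩⟩
  obtain ⟨N, p, hp⟩ := hφ (i A₀) (m A₀)
  refine ⟨p, i A₀, m A₀, N, ⟨A₀.1, ?_⟩, fun A => ?_, fun A => hA₀ ▸ hA₁ A, fun A => hp A.incl⟩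
  · rw [evalMatrix_mul, ← hp]
    exact mul_ne_zero A₀.2 (mul_ne_zero (h1 A₀) (pow_ne_zero _ A₀.2))
  -- Where the function detecting the minimal pair is nonzero, neither a larger `i` nor, for the
  -- minimal `i`, a larger `m` is possible.
  · have hne0 : φ (i A₀) (m A₀) A.incl ≠ 0 := fun h0 => A.right_ne_zero (by
      rw [show evalMatrix p A.1 = _ from (hp A.incl).symm, h0, zero_mul])
    have hi : i A.incl = i A₀ := by
      refine le_antisymm (not_lt.1 fun hlt => hne0 (h3 _ _ hlt _)) (hA₀ ▸ hA₁ _)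
    refine ⟨hi, le_antisymm (not_lt.1 fun hlt => hne0 ?_) (hA₀' _ (hi.trans hA₀))⟩
    rw [← hi]
    exact h2 _ _ hlt

end Regular

/-! ### Regular dependence of the discriminants. -/

section GenDiscr

lemma analyticAt_genDiscr {F : Type*} [NormedAddCommGroup F] [NormedSpace ℂ F] {d : ℕ}
    {a : F → Fin d → ℂ} {x : F} (ha : ∀ i, AnalyticAt ℂ (fun b => a b i) x) (i : ℕ) :
    AnalyticAt ℂ (fun b => genDiscr (monicPoly d (a b)) i) x := by
  obtain ⟨Q, hQ⟩ := exists_mvPolynomial_genDiscr d i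
  simp only [hQ]
  exact AnalyticAt.aeval_mvPolynomial ha Q

lemma iteratedDeriv_genDiscr_mem {ι : Type*} (M : Subalgebra ℂ (ι → ℂ)) {d : ℕ}
    {c : ι → ℂ → Fin d → ℂ} (hc : ∀ A i, AnalyticAt ℂ (fun s => c A s i) 0)
    (h : ∀ i k, (fun A => iteratedDeriv k (fun s => c A s i) 0) ∈ M) (i k : ℕ) :
    (fun A => iteratedDeriv k (fun s => genDiscr (monicPoly d (c A s)) i) 0) ∈ M := by
  obtain ⟨Q, hQ⟩ := exists_mvPolynomial_genDiscr d i
  simp only [hQ]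
  have han : ∀ (Q : MvPolynomial (Fin d) ℂ) A,
      AnalyticAt ℂ (fun s => MvPolynomial.eval (c A s) Q) 0 := fun Q A =>
    AnalyticAt.aeval_mvPolynomial (hc A) Q
  clear hQ
  induction Q using MvPolynomial.induction_on generalizing k with
  | C z =>
    simp only [MvPolynomial.eval_C, iteratedDeriv_const]
    exact M.algebraMap_mem (if k = 0 then z else 0)
  | add p q hp hq =>
    simp only [map_add]
    convert M.add_mem (hp k) (hq k) using 1
    funext A
    exact iteratedDeriv_add (han p A).contDiffAt (han q A).contDiffAt
  | mul_X p j hp =>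
    simp only [map_mul, MvPolynomial.eval_X]
    convert M.sum_mem (t := Finset.range (k + 1)) fun r _ =>
      M.smul_mem (M.mul_mem (hp r) (h j (k - r))) (k.choose r : ℂ) using 1
    funext A
    refine (iteratedDeriv_mul (han p A).contDiffAt (hc A j).contDiffAt).trans ?_
    simp only [Finset.sum_apply, Pi.smul_apply, Pi.mul_apply, smul_eq_mul, mul_assoc]

variable {B : Type*} [NormedAddCommGroup B] [NormedSpace ℂ B]

lemma HasWeierstrass.analyticAt_genDiscr {g : B × ℂ → ℂ} {d : ℕ} {a : B → Fin d → ℂ}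
    (h : HasWeierstrass g d a) (i : ℕ) :
    AnalyticAt ℂ (fun b => genDiscr (monicPoly d (a b)) i) 0 :=
  _root_.analyticAt_genDiscr h.1 i

lemma HasWeierstrass.iteratedDeriv_genDiscr_mem {ι : Type*} (M : Subalgebra ℂ (ι → ℂ))
    {g : ι → B × ℂ → ℂ} {d : ℕ} {a : ι → B → Fin d → ℂ} (h : ∀ A, HasWeierstrass (g A) d (a A))
    (v : B)
    (hg : ∀ i j, (fun A => mixedDeriv (fun q : ℂ × ℂ => g A (q.1 • v, q.2)) i j) ∈ M)
    (hd : (fun A => (iteratedDeriv d (fun z => g A (0, z)) 0)⁻¹) ∈ M) (i k : ℕ) :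
    (fun A => iteratedDeriv k (fun s : ℂ => genDiscr (monicPoly d (a A (s • v))) i) 0) ∈ M :=
  _root_.iteratedDeriv_genDiscr_mem M (c := fun A (s : ℂ) => a A (s • v))
    (fun A i => analyticAt_smul_line ((h A).1 i) v)
    (fun i k => HasWeierstrass.iteratedDeriv_mem M h v hg hd i k) i k

lemma HasWeierstrass.congr {g g' : B × ℂ → ℂ} {d : ℕ} {a : B → Fin d → ℂ}
    (h : HasWeierstrass g d a) (hg : ∀ᶠ q in 𝓝 0, g q = g' q) : HasWeierstrass g' d a := by
  obtain ⟨h1, h2, u, hu, hu0, h3⟩ := h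
  refine ⟨h1, h2, u, hu, hu0, ?_⟩
  filter_upwards [h3, hg] with q hq hq'
  rw [← hq', hq]

end GenDiscr

/-! ### Weierstrass polynomials and vanishing on slices. -/

section Slice
variable {B B' : Type*} [NormedAddCommGroup B] [NormedSpace ℂ B] [NormedAddCommGroup B']
  [NormedSpace ℂ B']

lemma HasWeierstrass.comp_clm {g : B × ℂ → ℂ} {d : ℕ} {a : B → Fin d → ℂ}
    (h : HasWeierstrass g d a) (L : B' →L[ℂ] B) :
    HasWeierstrass (fun q : B' × ℂ => g (L q.1, q.2)) d (fun b => a (L b)) := by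
  obtain ⟨ha, ha0, u, hu, hu0, h⟩ := h
  have h1 : Tendsto (fun q : B' × ℂ => (L q.1, q.2)) (𝓝 0) (𝓝 0) :=
    (by fun_prop : Continuous fun q : B' × ℂ => (L q.1, q.2)).tendsto' 0 0 (by simp)
  refine ⟨fun i => ?_, by simp [ha0], fun q => u (L q.1, q.2), ?_, ?_, h1.eventually h⟩
  · exact AnalyticAt.fun_comp_of_eq (g := fun b => a b i) (f := L) (ha i) (L.analyticAt _) (by simp)
  · refine AnalyticAt.fun_comp_of_eq (g := u) (f := fun q : B' × ℂ => (L q.1, q.2)) hu ?_ (by simp)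
    exact ((L.comp (ContinuousLinearMap.fst ℂ B' ℂ)).analyticAt _).prod analyticAt_snd
  · change u (L 0, 0) ≠ 0
    rwa [map_zero]

/-- The slices of a Weierstrass polynomial are Weierstrass polynomials, as long as the degree does
not drop. -/
lemma HasWeierstrass.slice {g : B' × ℂ → ℂ} {d : ℕ} {a : B' → Fin d → ℂ}
    (h : HasWeierstrass g d a) (κ : (ℂ × B) →L[ℂ] B') :
    ∀ᶠ b in 𝓝 (0 : ℂ), (∃ a', HasWeierstrass (fun q : B × ℂ => g (κ (b, q.1), q.2)) d a') →
      HasWeierstrass (fun q : B × ℂ => g (κ (b, q.1), q.2)) d (fun β => a (κ (b, β))) := by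
  obtain ⟨ha, ha0, u, hu, hu0, h⟩ := h
  have h1 : Tendsto (fun b : ℂ => κ (b, 0)) (𝓝 0) (𝓝 0) :=
    (by fun_prop : Continuous fun b : ℂ => κ (b, 0)).tendsto' 0 0 (map_zero κ)
  have h2 : Tendsto (fun b : ℂ => (κ (b, 0), (0 : ℂ))) (𝓝 0) (𝓝 0) :=
    (by fun_prop : Continuous fun b : ℂ => (κ (b, 0), (0 : ℂ))).tendsto' 0 0
      (by rw [show ((0 : ℂ), (0 : B)) = 0 from rfl, map_zero]; rfl)
  filter_upwards [h1.eventually (eventually_all.2 fun i => (ha i).eventually_analyticAt),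
    h2.eventually hu.eventually_analyticAt, h2.eventually (hu.continuousAt.eventually_ne hu0),
    h2.eventually h.eventually_nhds] with b hab hub hub0 hb ⟨a', ha'⟩
  have hlin : ∀ β, AnalyticAt ℂ (fun β : B => κ (b, β)) β := fun β =>
    (κ.analyticAt _).fun_comp (by fun_prop)
  have hlin' : AnalyticAt ℂ (fun q : B × ℂ => (κ (b, q.1), q.2)) 0 :=
    ((κ.analyticAt _).fun_comp (by fun_prop)).prod analyticAt_snd
  have h3 : Tendsto (fun q : B × ℂ => (κ (b, q.1), q.2)) (𝓝 0) (𝓝 (κ (b, 0), 0)) :=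
    hlin'.continuousAt.tendsto
  have h4 : Tendsto (fun z : ℂ => (κ (b, 0), z)) (𝓝 0) (𝓝 (κ (b, 0), 0)) :=
    (by fun_prop : Continuous fun z : ℂ => (κ (b, 0), z)).tendsto' _ _ rfl
  refine ⟨fun i => ?_, ?_, fun q => u (κ (b, q.1), q.2), ?_, hub0, h3.eventually hb⟩
  · exact AnalyticAt.fun_comp_of_eq (g := fun b => a b i) (f := fun β : B => κ (b, β)) (hab i)
      (hlin 0) rfl
  -- At the origin of the slice the germ has order exactly `d` in `z`; as `u` is a unit there, `z ^
  -- d` divides the monic polynomial of degree `d`, whose lower coefficients must vanish.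
  · obtain ⟨U, -, hU⟩ := ha'.taylorSeries_eq
    have h5 : AnalyticAt ℂ (fun z : ℂ => u (κ (b, 0), z)) 0 :=
      AnalyticAt.fun_comp_of_eq (g := u) (f := fun z : ℂ => (κ (b, 0), z)) hub (by fun_prop) rfl
    have h6 : taylorSeries (fun z => g (κ (b, 0), z)) = taylorSeries (fun z => u (κ (b, 0), z)) *
        (monicPoly d (a (κ (b, 0))) : PowerSeries ℂ) := by
      rw [← taylorSeries_eval, ← taylorSeries_mul h5 (AnalyticOnNhd.eval_polynomial _ 0 trivial)]
      exact taylorSeries_congr (h4.eventually hb)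
    have h7 : (monicPoly d (a (κ (b, 0))) : PowerSeries ℂ) =
        (taylorSeries fun z => u (κ (b, 0), z))⁻¹ * U * PowerSeries.X ^ d := by
      rw [mul_assoc, ← hU, h6, ← mul_assoc, PowerSeries.inv_mul_cancel, one_mul]
      rw [← PowerSeries.coeff_zero_eq_constantCoeff_apply, coeff_taylorSeries]
      simpa using hub0
    funext i
    change a (κ (b, 0)) i = 0
    rw [← coeff_monicPoly_of_lt (a (κ (b, 0))) i, ← Polynomial.coeff_coe, h7, PowerSeries.coeff_mul_X_pow',
      if_neg (by omega)]
  · exact AnalyticAt.fun_comp_of_eq (g := u) (f := fun q : B × ℂ => (κ (b, q.1), q.2)) hub hlin' rfl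

/-- A germ of analytic function that vanishes near the origin on each slice vanishes. -/
lemma eventually_eq_zero_of_slices {φ : B' → ℂ} (hφ : AnalyticAt ℂ φ 0) (κ : (ℂ × B) ≃L[ℂ] B')
    (h : ∀ᶠ b in 𝓝 (0 : ℂ), ∀ᶠ β in 𝓝 (0 : B), φ (κ (b, β)) = 0) :
    ∀ᶠ q in 𝓝 (0 : B'), φ q = 0 := by
  have h1 : Tendsto κ (𝓝 0) (𝓝 0) := κ.continuous.tendsto' 0 0 (map_zero κ)
  have h2 : Tendsto κ.symm (𝓝 0) (𝓝 0) := κ.symm.continuous.tendsto' 0 0 (map_zero _)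
  suffices hs : ∀ᶠ q in 𝓝 (0 : ℂ × B), φ (κ q) = 0 by
    filter_upwards [h2.eventually hs] with q hq
    rwa [κ.apply_symm_apply] at hq
  obtain ⟨r, hr, hr'⟩ := Metric.eventually_nhds_iff_ball.1 (h1.eventually hφ.eventually_analyticAt)
  have hball : ∀ᶠ q in 𝓝 (0 : ℂ × B), q ∈ Metric.ball (0 : ℂ) r ×ˢ Metric.ball (0 : B) r :=
    prod_mem_nhds (Metric.ball_mem_nhds _ hr) (Metric.ball_mem_nhds _ hr)
  filter_upwards [hball, (continuous_fst.tendsto' (0 : ℂ × B) 0 rfl).eventually h] with q hq hq'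
  have h3 : AnalyticOnNhd ℂ (fun β : B => φ (κ (q.1, β))) (Metric.ball 0 r) := fun β hβ => by
    refine AnalyticAt.fun_comp_of_eq (g := φ) (f := fun β : B => κ (q.1, β)) (hr' (q.1, β) ?_)
      (((κ : (ℂ × B) →L[ℂ] B').analyticAt _).fun_comp (by fun_prop)) rfl
    rw [← Prod.mk_zero_zero, ← ball_prod_same]
    exact ⟨hq.1, hβ⟩
  exact h3.eqOn_zero_of_preconnected_of_eventuallyEq_zero (convex_ball _ _).isPreconnected
    (Metric.mem_ball_self hr) hq' hq.2

/-- The slice `b = 0` shows that `g` has order `d` in `z`, so preparation applies; constancy of the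
order then makes restriction compatible with it. -/
lemma exists_hasWeierstrass_of_slices [CompleteSpace B'] {g : B' × ℂ → ℂ} (hg : AnalyticAt ℂ g 0)
    (κ : (ℂ × B) ≃L[ℂ] B') {d : ℕ}
    (h : ∀ᶠ b in 𝓝 (0 : ℂ), ∃ a, HasWeierstrass (fun q : B × ℂ => g (κ (b, q.1), q.2)) d a) :
    ∃ a, HasWeierstrass g d a ∧ ∀ᶠ b in 𝓝 (0 : ℂ),
      HasWeierstrass (fun q : B × ℂ => g (κ (b, q.1), q.2)) d (fun β => a (κ (b, β))) := by
  obtain ⟨a₀, ha₀⟩ := h.self_of_nhds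
  have h0 : κ (0, 0) = 0 := map_zero κ
  have h1 := @ha₀.iteratedDeriv_eq_zero
  have h2 := ha₀.iteratedDeriv_ne_zero
  simp only [h0] at h1 h2
  obtain ⟨a, ha⟩ := exists_hasWeierstrass hg (fun j hj => h1 hj) h2
  refine ⟨a, ha, ?_⟩
  filter_upwards [h, ha.slice (κ : (ℂ × B) →L[ℂ] B')] with b hb hb' using hb' hb

end Slice

/-! ### Equisingularity through numerical invariants, and passage to joint families. -/

section Types
variable {P P' : Type*} [NormedAddCommGroup P] [NormedSpace ℂ P] [NormedAddCommGroup P']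
  [NormedSpace ℂ P']

/-- The curve germs `D(·, ·, t) = 0` form an equisingular family with the numerical invariants
`m` (the order in `y`), `j` (the index of the first nonzero generalized discriminant) and `M` (the
order in `x` of this discriminant). -/
def HasCurveType (D : ℂ × ℂ × P → ℂ) (m j M : ℕ) : Prop :=
  (m ≠ 0 → ∀ᶠ t in 𝓝 (0 : P), D (0, 0, t) = 0) ∧ 1 ≤ j ∧ ∃ v : ℂ × P → Fin m → ℂ,
    HasWeierstrass (fun q : (ℂ × P) × ℂ => D (q.1.1, q.2, q.1.2)) m v ∧
    (∀ k, 1 ≤ k → k < j → ∀ᶠ c in 𝓝 (0 : ℂ × P), genDiscr (monicPoly m (v c)) k = 0) ∧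
    IsXOrder (fun c => genDiscr (monicPoly m (v c)) j) M

/-- The family `F` is Zariski equisingular with the numerical invariants `d` (the order in `z`), `i`
(the index of the first nonzero generalized discriminant), and the invariants of the latter. -/
def HasSurfaceType (F : (ℂ × ℂ × P) × ℂ → ℂ) (d i m j M : ℕ) : Prop :=
  1 ≤ i ∧ ∃ a : ℂ × ℂ × P → Fin d → ℂ, HasWeierstrass F d a ∧
    (∀ k, 1 ≤ k → k < i → ∀ᶠ b in 𝓝 (0 : ℂ × ℂ × P), genDiscr (monicPoly d (a b)) k = 0) ∧
    HasCurveType (fun b => genDiscr (monicPoly d (a b)) i) m j M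

lemma not_eventually_eq_zero_of_iteratedDeriv {φ : ℂ → ℂ} {m : ℕ} (h : iteratedDeriv m φ 0 ≠ 0) :
    ¬ ∀ᶠ z in 𝓝 0, φ z = 0 := fun h0 => h (by
  rw [Filter.EventuallyEq.iteratedDeriv_eq m (g := fun _ => 0) h0, iteratedDeriv_const]
  simp)

omit [NormedSpace ℂ P] in
lemma IsXOrder.not_eventually_eq_zero {E : ℂ × P → ℂ} {M : ℕ} (h : IsXOrder E M) :
    ¬ ∀ᶠ q in 𝓝 (0 : ℂ × P), E q = 0 := fun h0 =>
  not_eventually_eq_zero_of_iteratedDeriv h.2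
    (((by fun_prop : Continuous fun x : ℂ => ((x, 0) : ℂ × P)).tendsto' 0 0 rfl).eventually h0)

omit [NormedSpace ℂ P] in
lemma IsXOrder.congr {E E' : ℂ × P → ℂ} {M : ℕ} (h : IsXOrder E M)
    (hE : ∀ᶠ q in 𝓝 (0 : ℂ × P), E q = E' q) : IsXOrder E' M := by
  have h1 : ∀ᶠ t in 𝓝 (0 : P), ∀ j, iteratedDeriv j (fun x => E (x, t)) 0 =
      iteratedDeriv j (fun x => E' (x, t)) 0 := by
    filter_upwards [tendsto_zero_prodMk.eventually hE.eventually_nhds] with t ht j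
    exact Filter.EventuallyEq.iteratedDeriv_eq j
      (((by fun_prop : Continuous fun x : ℂ => (x, t)).tendsto' 0 (0, t) rfl).eventually ht)
  refine ⟨?_, by rw [← h1.self_of_nhds]; exact h.2⟩
  filter_upwards [h1, h.1] with t ht ht' j hj
  rw [← ht, ht' j hj]

omit [NormedSpace ℂ P] in
lemma tendsto_curve_swap :
    Tendsto (fun q : (ℂ × P) × ℂ => ((q.1.1, q.2, q.1.2) : ℂ × ℂ × P)) (𝓝 0) (𝓝 0) :=
  (by fun_prop : Continuous fun q : (ℂ × P) × ℂ => ((q.1.1, q.2, q.1.2) : ℂ × ℂ × P)).tendsto' 0 0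
    rfl

lemma analyticAt_curve_swap {D : ℂ × ℂ × P → ℂ} (hD : AnalyticAt ℂ D 0) :
    AnalyticAt ℂ (fun q : (ℂ × P) × ℂ => D (q.1.1, q.2, q.1.2)) 0 :=
  AnalyticAt.fun_comp_of_eq (g := D) (f := fun q : (ℂ × P) × ℂ => (q.1.1, q.2, q.1.2)) hD
    (by fun_prop) rfl

lemma HasCurveType.congr {D D' : ℂ × ℂ × P → ℂ} {m j M : ℕ} (h : HasCurveType D m j M)
    (hD : ∀ᶠ q in 𝓝 0, D q = D' q) : HasCurveType D' m j M := by
  obtain ⟨h0, hj, v, hv, hk, hx⟩ := h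
  refine ⟨fun hm => ?_, hj, v, hv.congr (tendsto_curve_swap.eventually hD), hk, hx⟩
  have h1 : Tendsto (fun t : P => ((0, 0, t) : ℂ × ℂ × P)) (𝓝 0) (𝓝 0) :=
    (by fun_prop : Continuous fun t : P => ((0, 0, t) : ℂ × ℂ × P)).tendsto' 0 0 rfl
  filter_upwards [h0 hm, h1.eventually hD] with t ht ht'
  rw [← ht', ht]

lemma HasCurveType.iteratedDeriv_ne_zero {D : ℂ × ℂ × P → ℂ} {m j M : ℕ}
    (h : HasCurveType D m j M) : iteratedDeriv m (fun y => D (0, y, 0)) 0 ≠ 0 := by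
  obtain ⟨-, -, v, hv, -⟩ := h
  exact hv.iteratedDeriv_ne_zero

lemma HasCurveType.iteratedDeriv_eq_zero {D : ℂ × ℂ × P → ℂ} {m j M k : ℕ}
    (h : HasCurveType D m j M) (hk : k < m) : iteratedDeriv k (fun y => D (0, y, 0)) 0 = 0 := by
  obtain ⟨-, -, v, hv, -⟩ := h
  exact hv.iteratedDeriv_eq_zero hk

lemma HasCurveType.not_eventually_eq_zero {D : ℂ × ℂ × P → ℂ} {m j M : ℕ}
    (h : HasCurveType D m j M) : ¬ ∀ᶠ q in 𝓝 0, D q = 0 := fun h0 =>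
  not_eventually_eq_zero_of_iteratedDeriv h.iteratedDeriv_ne_zero
    (((by fun_prop : Continuous fun y : ℂ => ((0, y, 0) : ℂ × ℂ × P)).tendsto' 0 0 rfl).eventually
      h0)

lemma genDiscr_monicPoly_zero_one (c : Fin 0 → ℂ) : genDiscr (monicPoly 0 c) 1 = 1 := by
  simp [genDiscr, natDegree_monicPoly]

lemma IsEquisingularCurveFamily.exists_hasCurveType [CompleteSpace P] {D : ℂ × ℂ × P → ℂ}
    (hD : AnalyticAt ℂ D 0) (h : IsEquisingularCurveFamily D) : ∃ m j M, HasCurveType D m j M := by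
  obtain ⟨-, h0 | ⟨h0, E, ⟨W, hW, j, hj, hlow, hne, rfl⟩, hE⟩⟩ := h
  -- A unit has Weierstrass polynomial `1`, whose first generalized discriminant is an empty product
  -- equal to `1`; hence `m = 0`, `j = 1`, `M = 0`.
  · obtain ⟨v, hv⟩ := exists_hasWeierstrass (d := 0) (analyticAt_curve_swap hD) (by simp)
      (by rw [iteratedDeriv_zero]; exact h0)
    refine ⟨0, 1, 0, fun h => absurd rfl h, le_rfl, v, hv, fun k hk hk' => by omega, ?_⟩
    simp [IsXOrder, genDiscr_monicPoly_zero_one]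
  · obtain ⟨m, v, hv, rfl⟩ := isWeierstrassPoly_iff.1 hW
    obtain ⟨M, hM⟩ := exists_isXOrder_of_mult_eq (hv.analyticAt_genDiscr j) hne hE
    exact ⟨m, j, M, fun _ => h0, hj, v, hv, hlow, hM⟩

lemma HasCurveType.isEquisingularCurveFamily {D : ℂ × ℂ × P → ℂ} {m j M : ℕ}
    (h : HasCurveType D m j M) : IsEquisingularCurveFamily D := by
  refine ⟨not_eventually_eq_zero_of_iteratedDeriv h.iteratedDeriv_ne_zero, ?_⟩
  by_cases hm : m = 0
  · subst hm
    have h1 := h.iteratedDeriv_ne_zero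
    rw [iteratedDeriv_zero] at h1
    exact Or.inl h1
  · obtain ⟨h0, hj, v, hv, hk, hx⟩ := h
    exact Or.inr ⟨h0 hm, _, ⟨_, isWeierstrassPoly_iff.2 ⟨m, v, hv, rfl⟩, j, hj, hk,
      hx.not_eventually_eq_zero, rfl⟩, hx.mult_eq (hv.analyticAt_genDiscr j)⟩

lemma HasSurfaceType.exists_isFirstDiscr {F : (ℂ × ℂ × P) × ℂ → ℂ} {d i m j M : ℕ}
    (h : HasSurfaceType F d i m j M) :
    ∃ D, IsFirstDiscr F D ∧ IsEquisingularCurveFamily D := by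
  obtain ⟨hi, a, ha, hk, h⟩ := h
  exact ⟨_, ⟨_, isWeierstrassPoly_iff.2 ⟨d, a, ha, rfl⟩, i, hi, hk, h.not_eventually_eq_zero, rfl⟩,
    h.isEquisingularCurveFamily⟩

lemma exists_hasSurfaceType [CompleteSpace P] {F : (ℂ × ℂ × P) × ℂ → ℂ} {D : ℂ × ℂ × P → ℂ}
    (hF : IsFirstDiscr F D) (hD : IsEquisingularCurveFamily D) :
    ∃ d i m j M, HasSurfaceType F d i m j M := by
  obtain ⟨W, hW, i, hi, hlow, -, rfl⟩ := hF
  obtain ⟨d, a, ha, rfl⟩ := isWeierstrassPoly_iff.1 hW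
  obtain ⟨m, j, M, h⟩ := hD.exists_hasCurveType (ha.analyticAt_genDiscr i)
  exact ⟨d, i, m, j, M, hi, a, ha, hlow, h⟩

lemma HasCurveType.comp_clm {D : ℂ × ℂ × P → ℂ} {m j M : ℕ} (h : HasCurveType D m j M)
    (L : P' →L[ℂ] P) : HasCurveType (fun q => D (q.1, q.2.1, L q.2.2)) m j M := by
  obtain ⟨h0, hj, v, hv, hk, hx⟩ := h
  have hL : Tendsto L (𝓝 0) (𝓝 0) := L.continuous.tendsto' 0 0 (map_zero L)
  have hL' : Tendsto ((ContinuousLinearMap.id ℂ ℂ).prodMap L) (𝓝 0) (𝓝 0) :=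
    ((ContinuousLinearMap.id ℂ ℂ).prodMap L).continuous.tendsto' 0 0 (map_zero _)
  refine ⟨fun hm => hL.eventually (h0 hm), hj, _, hv.comp_clm ((ContinuousLinearMap.id ℂ ℂ).prodMap L),
    fun k hk1 hk2 => hL'.eventually (hk k hk1 hk2), hL.eventually hx.1, ?_⟩
  simpa using hx.2

lemma HasSurfaceType.comp_clm {F : (ℂ × ℂ × P) × ℂ → ℂ} {d i m j M : ℕ}
    (h : HasSurfaceType F d i m j M) (L : P' →L[ℂ] P) :
    HasSurfaceType (fun q => F ((q.1.1, q.1.2.1, L q.1.2.2), q.2)) d i m j M := by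
  obtain ⟨hi, a, ha, hk, h⟩ := h
  set L' : (ℂ × ℂ × P') →L[ℂ] ℂ × ℂ × P :=
    (ContinuousLinearMap.id ℂ ℂ).prodMap ((ContinuousLinearMap.id ℂ ℂ).prodMap L)
  have hL' : Tendsto L' (𝓝 0) (𝓝 0) := L'.continuous.tendsto' 0 0 (map_zero _)
  exact ⟨hi, _, ha.comp_clm L', fun k hk1 hk2 => hL'.eventually (hk k hk1 hk2), h.comp_clm L⟩

/-- `(b, x, t) ↦ (x, b, t)`. -/
def swapCurve (P : Type*) [NormedAddCommGroup P] [NormedSpace ℂ P] :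
    (ℂ × (ℂ × P)) ≃L[ℂ] ℂ × (ℂ × P) where
  toFun q := (q.2.1, q.1, q.2.2)
  invFun q := (q.2.1, q.1, q.2.2)
  map_add' _ _ := rfl
  map_smul' _ _ := rfl
  left_inv _ := rfl
  right_inv _ := rfl
  continuous_toFun := by fun_prop
  continuous_invFun := by fun_prop

/-- `(b, x, y, t) ↦ (x, y, b, t)`. -/
def swapSurface (P : Type*) [NormedAddCommGroup P] [NormedSpace ℂ P] :
    (ℂ × (ℂ × ℂ × P)) ≃L[ℂ] ℂ × ℂ × (ℂ × P) where
  toFun q := (q.2.1, q.2.2.1, q.1, q.2.2.2)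
  invFun q := (q.2.2.1, q.1, q.2.1, q.2.2.2)
  map_add' _ _ := rfl
  map_smul' _ _ := rfl
  left_inv _ := rfl
  right_inv _ := rfl
  continuous_toFun := by fun_prop
  continuous_invFun := by fun_prop

lemma analyticAt_iteratedDeriv_fst {E : ℂ × P → ℂ} (hE : AnalyticAt ℂ E 0) (k : ℕ) :
    AnalyticAt ℂ (fun t => iteratedDeriv k (fun x => E (x, t)) 0) 0 := by
  have h1 : AnalyticAt ℂ (fun t : P => iteratedFDeriv ℂ k E (0, t)) 0 :=
    AnalyticAt.fun_comp_of_eq (g := iteratedFDeriv ℂ k E) (f := fun t : P => ((0, t) : ℂ × P))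
      (analyticAt_iteratedFDeriv hE k) (by fun_prop) rfl
  have h2 := (ContinuousMultilinearMap.apply ℂ (fun _ : Fin k => ℂ × P) ℂ
    (fun _ => (1, 0))).analyticAt (iteratedFDeriv ℂ k E (0, 0))
  refine (AnalyticAt.fun_comp_of_eq (f := fun t : P => iteratedFDeriv ℂ k E (0, t)) h2 h1 rfl).congr ?_
  filter_upwards [tendsto_zero_prodMk.eventually hE.eventually_analyticAt] with t ht
  rw [iteratedDeriv_fst_eq ht]
  rfl

/-- The lower `x`-derivatives vanish on each slice, hence jointly; exactness of the order is needed
only at the origin and comes from the slice `b = 0`. -/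
lemma IsXOrder.joint {E : ℂ × (ℂ × P) → ℂ} (hE : AnalyticAt ℂ E 0) {M : ℕ}
    (h : ∀ᶠ b in 𝓝 (0 : ℂ), IsXOrder (fun q : ℂ × P => E (q.1, b, q.2)) M) : IsXOrder E M := by
  refine ⟨(eventually_all_finite (Set.finite_Iio M)).2 fun k hk => ?_, h.self_of_nhds.2⟩
  refine eventually_eq_zero_of_slices (analyticAt_iteratedDeriv_fst hE k)
    (ContinuousLinearEquiv.refl ℂ (ℂ × P)) ?_
  filter_upwards [h] with b hb
  filter_upwards [hb.1] with t ht using ht k hk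

/-- By uniqueness, the restriction of the joint Weierstrass polynomial to a slice is the one giving
the type of this slice, so the conditions on discriminants transfer slice by slice. -/
lemma HasCurveType.joint [CompleteSpace P] {D : ℂ × ℂ × (ℂ × P) → ℂ} (hD : AnalyticAt ℂ D 0)
    {m j M : ℕ} (h : ∀ᶠ b in 𝓝 (0 : ℂ),
      HasCurveType (fun q : ℂ × ℂ × P => D (q.1, q.2.1, (b, q.2.2))) m j M) :
    HasCurveType D m j M := by
  obtain ⟨v, hv, hvb⟩ := exists_hasWeierstrass_of_slices (d := m) (analyticAt_curve_swap hD)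
    (swapCurve P) (by
      filter_upwards [h] with b hb
      obtain ⟨-, -, v, hv, -⟩ := hb
      exact ⟨v, hv⟩)
  refine ⟨fun hm => ?_, h.self_of_nhds.2.1, v, hv, fun k hk1 hk2 => ?_, ?_⟩
  · have h1 : AnalyticAt ℂ (fun t : ℂ × P => D (0, 0, t)) 0 :=
      AnalyticAt.fun_comp_of_eq (g := D) (f := fun t : ℂ × P => (0, 0, t)) hD (by fun_prop) rfl
    refine eventually_eq_zero_of_slices h1 (ContinuousLinearEquiv.refl ℂ (ℂ × P)) ?_
    filter_upwards [h] with b hb using hb.1 hm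
  · refine eventually_eq_zero_of_slices (hv.analyticAt_genDiscr k) (swapCurve P) ?_
    filter_upwards [h, hvb] with b hb hvb'
    obtain ⟨-, -, v', hv', hk, -⟩ := hb
    filter_upwards [hv'.eventuallyEq hvb', hk k hk1 hk2] with c hc hc'
    rw [← hc, hc']
  · refine IsXOrder.joint (hv.analyticAt_genDiscr j) ?_
    filter_upwards [h, hvb] with b hb hvb'
    obtain ⟨-, -, v', hv', -, hx⟩ := hb
    refine hx.congr ?_
    filter_upwards [hv'.eventuallyEq hvb'] with c hc
    rw [hc]
    rfl

/-- A family of families of surface germs of the same type has this type. -/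
lemma HasSurfaceType.joint [CompleteSpace P] {F : (ℂ × ℂ × (ℂ × P)) × ℂ → ℂ}
    (hF : AnalyticAt ℂ F 0) {d i m j M : ℕ} (h : ∀ᶠ b in 𝓝 (0 : ℂ), HasSurfaceType
      (fun q : (ℂ × ℂ × P) × ℂ => F ((q.1.1, q.1.2.1, (b, q.1.2.2)), q.2)) d i m j M) :
    HasSurfaceType F d i m j M := by
  obtain ⟨a, ha, hab⟩ := exists_hasWeierstrass_of_slices (d := d) hF (swapSurface P) (by
    filter_upwards [h] with b hb
    obtain ⟨-, a, ha, -⟩ := hb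
    exact ⟨a, ha⟩)
  refine ⟨h.self_of_nhds.1, a, ha, fun k hk1 hk2 => ?_,
    HasCurveType.joint (ha.analyticAt_genDiscr i) ?_⟩
  · refine eventually_eq_zero_of_slices (ha.analyticAt_genDiscr k) (swapSurface P) ?_
    filter_upwards [h, hab] with b hb hab'
    obtain ⟨-, a', ha', hk, -⟩ := hb
    filter_upwards [ha'.eventuallyEq hab', hk k hk1 hk2] with c hc hc'
    rw [← hc, hc']
  · filter_upwards [h, hab] with b hb hab'
    obtain ⟨-, a', ha', -, hc⟩ := hb
    refine hc.congr ?_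
    filter_upwards [ha'.eventuallyEq hab'] with c hc
    rw [hc]
    rfl

end Types

/-! ### Generic constancy of the invariants. -/

section Passes
variable {P : Type*} [NormedAddCommGroup P] [NormedSpace ℂ P]

/-- The germ `f` as a function of the last variable `z`, with parameters `x, y, t`. -/
def projGerm (f : (Fin 3 → ℂ) × P → ℂ) : (ℂ × ℂ × P) × ℂ → ℂ :=
  fun q => f (![q.1.1, q.1.2.1, q.2], q.1.2.2)

omit [NormedSpace ℂ P] in
lemma projGerm_linearChange_smul (f : (Fin 3 → ℂ) × P → ℂ)
    (A : Matrix.GeneralLinearGroup (Fin 3) ℂ) (s x y z : ℂ) :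
    projGerm (linearChange f A) ((s * x, s * y, 0), s * z) =
      f (s • (A : Matrix (Fin 3) (Fin 3) ℂ).mulVec ![x, y, z], 0) := by
  simp only [projGerm, linearChange, ← Matrix.mulVec_smul]
  simp

lemma analyticAt_fiber_zero {f : (Fin 3 → ℂ) × P → ℂ} (hf : AnalyticAt ℂ f 0) :
    AnalyticAt ℂ (fun v => f (v, 0)) 0 :=
  AnalyticAt.fun_comp_of_eq (g := f) (f := fun v : Fin 3 → ℂ => (v, (0 : P))) hf (by fun_prop) rfl

/-- Along lines in the plane of `(x, y, 0)` and `(0, 0, 1)` the Taylor coefficients of `f_0 ∘ A` are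
polynomials in `A`; polarization passes to mixed derivatives. -/
lemma mixedDeriv_projGerm_mem {f : (Fin 3 → ℂ) × P → ℂ} (hf : AnalyticAt ℂ f 0)
    (h : MvPolynomial (Fin 3 × Fin 3) ℂ) (x y : ℂ) (i j : ℕ) :
    (fun A : Locus h => mixedDeriv (fun q : ℂ × ℂ =>
      projGerm (linearChange f A.1) (q.1 • (x, y, 0), q.2)) i j) ∈ regularFunctions h := by
  have hg := analyticAt_fiber_zero hf
  have hline : ∀ (A : Locus h) (q : ℂ × ℂ),
      projGerm (linearChange f A.1) (q.1 • (x, y, 0), q.2) = f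
        ((A.1 : Matrix (Fin 3) (Fin 3) ℂ).mulVec (q.1 • ![x, y, 0] + q.2 • ![0, 0, 1]), 0) := by
    intro A q
    simp [projGerm, linearChange]
  simp only [hline]
  refine mixedDeriv_mem_of_lines (Subalgebra.toSubmodule (regularFunctions h)) (fun A => ?_)
    (fun a b k => ?_) i j
  · refine AnalyticAt.fun_comp_of_eq (g := fun v => f (v, 0)) (f := fun q : ℂ × ℂ =>
      (A.1 : Matrix (Fin 3) (Fin 3) ℂ).mulVec (q.1 • ![x, y, 0] + q.2 • ![0, 0, 1])) hg ?_ (by simp)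
    refine AnalyticAt.fun_comp_of_eq (g := (A.1 : Matrix (Fin 3) (Fin 3) ℂ).mulVec)
      (f := fun q : ℂ × ℂ => q.1 • ![x, y, 0] + q.2 • ![0, 0, 1])
      ((Matrix.mulVecLin (A.1 : Matrix (Fin 3) (Fin 3) ℂ)).toContinuousLinearMap.analyticAt _)
      (by fun_prop) rfl
  · obtain ⟨p, hp⟩ := exists_evalMatrix_eq_iteratedDeriv hg (a • ![x, y, 0] + b • ![0, 0, 1]) k
    refine mem_regularFunctions_of_eq p fun A => ?_
    rw [← hp]
    simp only [← Matrix.mulVec_smul, smul_add, smul_smul]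

lemma iteratedDeriv_projGerm_mem {f : (Fin 3 → ℂ) × P → ℂ} (hf : AnalyticAt ℂ f 0)
    (h : MvPolynomial (Fin 3 × Fin 3) ℂ) (k : ℕ) :
    (fun A : Locus h => iteratedDeriv k (fun z =>
      projGerm (linearChange f A.1) (0, z)) 0) ∈ regularFunctions h := by
  have h1 := mixedDeriv_projGerm_mem hf h 0 0 0 k
  simpa only [mixedDeriv, iteratedDeriv_zero, zero_smul] using h1

lemma Locus.coe_incl {h p : MvPolynomial (Fin 3 × Fin 3) ℂ} (A : Locus (h * p)) :
    A.incl.1 = A.1 := rfl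

/-- On a nonempty principal open subset of `GL₃(ℂ)` the order in `z` is constant. -/
lemma exists_locus_degree {f : (Fin 3 → ℂ) × P → ℂ} (hf : AnalyticAt ℂ f 0)
    {h : MvPolynomial (Fin 3 × Fin 3) ℂ} (hne : Nonempty (Locus h))
    (hZ : ∀ A : Locus h, ∃ d i m j M, HasSurfaceType (projGerm (linearChange f A.1)) d i m j M) :
    ∃ p d, Nonempty (Locus (h * p)) ∧
      (∀ A : Locus (h * p), ∃ i m j M,
        HasSurfaceType (projGerm (linearChange f A.1)) d i m j M) ∧
      (fun A : Locus (h * p) =>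
        (iteratedDeriv d (fun z => projGerm (linearChange f A.1) (0, z)) 0)⁻¹) ∈
          regularFunctions (h * p) := by
  choose dd hdd using hZ
  -- Only one invariant is at stake, so the first of the two is taken constant.
  obtain ⟨p, i₁, d, N, hne', hconst, -, hinv⟩ := exists_locus_const hne (fun _ => 0) dd
    (fun _ k A => iteratedDeriv k (fun z => projGerm (linearChange f A.1) (0, z)) 0)
    (fun _ k => iteratedDeriv_projGerm_mem hf h k)
    (fun A => by
      obtain ⟨i, m, j, M, -, a, ha, -⟩ := hdd A
      exact ha.iteratedDeriv_ne_zero)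
    (fun A k hk => by
      obtain ⟨i, m, j, M, -, a, ha, -⟩ := hdd A
      exact ha.iteratedDeriv_eq_zero hk)
    (fun _ _ h => absurd h (lt_irrefl 0))
  refine ⟨p, d, hne', fun A => ?_, inv_mem_regularFunctions hinv⟩
  have h1 := hdd A.incl
  rwa [(hconst A).2] at h1

/-- For a regular family of polynomials whose coefficients are germs in `x, y, t`, the index of the
first nonzero generalized discriminant and its order in `y` are constant on a nonempty principal
open subset of `GL₃(ℂ)`. -/
lemma exists_locus_discr_order {h : MvPolynomial (Fin 3 × Fin 3) ℂ} (hne : Nonempty (Locus h))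
    {d : ℕ} {a : Locus h → ℂ × ℂ × P → Fin d → ℂ} {i m j M : Locus h → ℕ}
    (hreg : ∀ i k, (fun A => iteratedDeriv k
      (fun s : ℂ => genDiscr (monicPoly d (a A (0, s, 0))) i) 0) ∈ regularFunctions h)
    (hi : ∀ A, 1 ≤ i A)
    (hk : ∀ A k, 1 ≤ k → k < i A → ∀ᶠ b in 𝓝 0, genDiscr (monicPoly d (a A b)) k = 0)
    (hc : ∀ A, HasCurveType (fun b => genDiscr (monicPoly d (a A b)) (i A)) (m A) (j A) (M A)) :
    ∃ p i₀ m₀, Nonempty (Locus (h * p)) ∧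
      (∀ A : Locus (h * p), i A.incl = i₀ ∧ m A.incl = m₀) ∧
      (fun A : Locus (h * p) => (iteratedDeriv m₀
        (fun s : ℂ => genDiscr (monicPoly d (a A.incl (0, s, 0))) i₀) 0)⁻¹) ∈
          regularFunctions (h * p) := by
  have ht : Tendsto (fun s : ℂ => ((0, s, 0) : ℂ × ℂ × P)) (𝓝 0) (𝓝 0) :=
    (by fun_prop : Continuous fun s : ℂ => ((0, s, 0) : ℂ × ℂ × P)).tendsto' 0 0 rfl
  obtain ⟨p, i₀, m₀, N, hne', hconst, -, hinv⟩ := exists_locus_const hne i m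
    (fun i k A => iteratedDeriv k (fun s : ℂ => genDiscr (monicPoly d (a A (0, s, 0))) i) 0) hreg
    (fun A => (hc A).iteratedDeriv_ne_zero) (fun A k hk => (hc A).iteratedDeriv_eq_zero hk)
    -- A discriminant of index below `i A` vanishes identically for `A`, hence on the `y`-axis,
    -- where nonvanishing is tested.
    (fun A A' hlt k => by
      by_contra hne
      exact not_eventually_eq_zero_of_iteratedDeriv hne (ht.eventually (hk A _ (hi A') hlt)))
  exact ⟨p, i₀, m₀, hne', hconst, inv_mem_regularFunctions hinv⟩

/-- The invariants of a regular family of equisingular families of curve germs of the same order are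
constant on a nonempty principal open subset of `GL₃(ℂ)`. -/
lemma exists_locus_hasCurveType {h : MvPolynomial (Fin 3 × Fin 3) ℂ} (hne : Nonempty (Locus h))
    {D : Locus h → ℂ × ℂ × P → ℂ} {m : ℕ}
    (hreg : ∀ (x y : ℂ) (k : ℕ), (fun A => iteratedDeriv k (fun s : ℂ => D A (s * x, s * y, 0)) 0) ∈
      regularFunctions h)
    (hinv : (fun A => (iteratedDeriv m (fun s : ℂ => D A (0, s, 0)) 0)⁻¹) ∈ regularFunctions h)
    (hD : ∀ A, ∃ j M, HasCurveType (D A) m j M) :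
    ∃ p j₀ M₀, Nonempty (Locus (h * p)) ∧
      ∀ A : Locus (h * p), HasCurveType (D A.incl) m j₀ M₀ := by
  have hD' := hD
  unfold HasCurveType at hD'
  choose j M h0 hj v hv hkv hx using hD'
  have ht : Tendsto (fun s : ℂ => ((s, 0) : ℂ × P)) (𝓝 0) (𝓝 0) :=
    (by fun_prop : Continuous fun s : ℂ => ((s, 0) : ℂ × P)).tendsto' 0 0 rfl
  have hregv : ∀ i k, (fun A : Locus h => iteratedDeriv k
      (fun s : ℂ => genDiscr (monicPoly m (v A (s • (1, 0)))) i) 0) ∈ regularFunctions h := by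
    intro i k
    refine HasWeierstrass.iteratedDeriv_genDiscr_mem _ hv (1, 0) (fun i j => ?_) ?_ i k
    · refine mixedDeriv_mem_of_lines (Subalgebra.toSubmodule (regularFunctions h))
        (fun A => analyticAt_line_fst (hv A).analyticAt _) (fun x y k => ?_) i j
      simpa using hreg x y k
    · simpa only [Prod.fst_zero, Prod.snd_zero] using hinv
  have hs : ∀ s : ℂ, s • ((1, 0) : ℂ × P) = (s, 0) := fun s => by simp
  simp only [hs] at hregv
  obtain ⟨p, j₀, M₀, N, hne', hconst, -⟩ := exists_locus_const hne j M
    (fun i k A => iteratedDeriv k (fun s : ℂ => genDiscr (monicPoly m (v A (s, 0))) i) 0) hregv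
    (fun A => (hx A).2) (fun A k hk => (hx A).1.self_of_nhds k hk)
    (fun A A' hlt k => by
      by_contra hne
      exact not_eventually_eq_zero_of_iteratedDeriv hne (ht.eventually (hkv A _ (hj A') hlt)))
  refine ⟨p, j₀, M₀, hne', fun A => ?_⟩
  rw [← (hconst A).1, ← (hconst A).2]
  exact ⟨h0 A.incl, hj A.incl, v A.incl, hv A.incl, hkv A.incl, hx A.incl⟩

/-- On a nonempty principal open subset of `GL₃(ℂ)` the numerical invariants are constant. -/
lemma exists_locus_hasSurfaceType {f : (Fin 3 → ℂ) × P → ℂ} (hf : AnalyticAt ℂ f 0)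
    {h₀ : MvPolynomial (Fin 3 × Fin 3) ℂ} (hne : Nonempty (Locus h₀))
    (hZ : ∀ A : Locus h₀, ∃ d i m j M, HasSurfaceType (projGerm (linearChange f A.1)) d i m j M) :
    ∃ h d i m j M, Nonempty (Locus h) ∧
      ∀ A : Locus h, HasSurfaceType (projGerm (linearChange f A.1)) d i m j M := by
  obtain ⟨p₁, d, hne₁, hT₁, hinv₁⟩ := exists_locus_degree hf hne hZ
  unfold HasSurfaceType at hT₁
  choose i m j M hi a ha hk hc using hT₁
  have hreg : ∀ (x y : ℂ) (i k : ℕ), (fun A : Locus (h₀ * p₁) => iteratedDeriv k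
      (fun s : ℂ => genDiscr (monicPoly d (a A (s • (x, y, 0)))) i) 0) ∈
        regularFunctions (h₀ * p₁) := fun x y i k =>
    HasWeierstrass.iteratedDeriv_genDiscr_mem _ ha (x, y, 0)
      (fun i j => mixedDeriv_projGerm_mem hf _ x y i j) hinv₁ i k
  have hs : ∀ s x y : ℂ, s • ((x, y, 0) : ℂ × ℂ × P) = (s * x, s * y, 0) := fun s x y => by simp
  simp only [hs] at hreg
  have hreg0 := hreg 0 1
  simp only [mul_zero, mul_one] at hreg0
  obtain ⟨p₂, i₀, m₀, hne₂, hconst, hinv₂⟩ := exists_locus_discr_order hne₁ hreg0 hi hk hc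
  obtain ⟨p₃, j₀, M₀, hne₃, hc₃⟩ := exists_locus_hasCurveType hne₂
    (D := fun A b => genDiscr (monicPoly d (a A.incl b)) i₀)
    (fun x y k => comp_incl_mem_regularFunctions (hreg x y i₀ k) p₂) hinv₂ (fun A => by
      have h1 := hc A.incl
      rw [(hconst A).1, (hconst A).2] at h1
      exact ⟨_, _, h1⟩)
  refine ⟨h₀ * p₁ * p₂ * p₃, d, i₀, m₀, j₀, M₀, hne₃, fun A => ?_⟩
  have hi₀ := hi A.incl.incl
  have hk₀ := hk A.incl.incl
  have ha₀ := ha A.incl.incl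
  rw [(hconst A.incl).1] at hi₀ hk₀
  rw [Locus.coe_incl, Locus.coe_incl] at ha₀
  exact ⟨hi₀, a A.incl.incl, ha₀, hk₀, hc₃ A⟩

end Passes

/-! ### Transversality and equisingularity from constancy of the invariants. -/

section Transversality
variable {P : Type*} [NormedAddCommGroup P] [NormedSpace ℂ P]

/-- Principal open sets are open in the classical topology, so small perturbations of the
coordinates stay in the set where the invariants are constant. -/
lemma Locus.eventually_exists_mul {h : MvPolynomial (Fin 3 × Fin 3) ℂ} (A : Locus h) {X : Type*}
    [TopologicalSpace X] {S : X → Matrix (Fin 3) (Fin 3) ℂ} {x₀ : X} (hS : Continuous S)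
    (h1 : S x₀ = 1) :
    ∀ᶠ x in 𝓝 x₀, ∃ B : Locus h, (B.1 : Matrix (Fin 3) (Fin 3) ℂ) = A.1 * S x := by
  have hc : Continuous fun x => (A.1 : Matrix (Fin 3) (Fin 3) ℂ) * S x := continuous_const.mul hS
  have h2 : Continuous fun x => evalMatrix h (A.1 * S x) :=
    (MvPolynomial.continuous_eval h).comp (continuous_pi fun ij => hc.matrix_elem ij.1 ij.2)
  have hA : (A.1 : Matrix (Fin 3) (Fin 3) ℂ).det ≠ 0 :=
    ((Matrix.isUnit_iff_isUnit_det _).1 A.1.isUnit).ne_zero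
  filter_upwards [h2.continuousAt.eventually_ne (y := 0) (by simpa [h1] using A.2),
    hc.matrix_det.continuousAt.eventually_ne (y := 0) (by simpa [h1] using hA)] with x hx hx'
  exact ⟨⟨Matrix.GeneralLinearGroup.mkOfDetNeZero _ hx', hx⟩, rfl⟩

variable {f : (Fin 3 → ℂ) × P → ℂ} {h : MvPolynomial (Fin 3 × Fin 3) ℂ} {d i m j M : ℕ}

lemma zAxis_notMem_tangentConeZero (hf : AnalyticAt ℂ f 0)
    (hT : ∀ A : Locus h, HasSurfaceType (projGerm (linearChange f A.1)) d i m j M) (A : Locus h) :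
    ![0, 0, 1] ∉ tangentConeZero (fun v => linearChange f A.1 (v, 0)) := by
  have hg := analyticAt_fiber_zero hf
  have hline : ∀ (A : Matrix.GeneralLinearGroup (Fin 3) ℂ) (s : ℂ),
      projGerm (linearChange f A) (0, s) =
        f (s • (A : Matrix (Fin 3) (Fin 3) ℂ).mulVec ![0, 0, 1], 0) := fun A s => by
    have h1 := projGerm_linearChange_smul f A s 0 0 1
    rwa [mul_zero, mul_one] at h1
  have hzero : ∀ k < d, ∀ v, iteratedDeriv k (fun s : ℂ => f (s • v, 0)) 0 = 0 := by
    intro k hk v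
    obtain ⟨p, hp⟩ := exists_evalMatrix_eq_iteratedDeriv hg ![0, 0, 1] k
    have hp0 : p = 0 := eq_zero_of_evalMatrix_eq_zero ⟨A⟩ fun A' => by
      obtain ⟨-, a, ha, -⟩ := hT A'
      have h1 := ha.iteratedDeriv_eq_zero hk
      simp only [hline] at h1
      rw [← hp, h1]
    -- The coefficient polynomial is zero, so it may be evaluated at a singular matrix: the one with
    -- all columns equal to `v` maps the `z`-axis to any prescribed direction.
    have h1 := hp (Matrix.of fun r _ => v r)
    have h2 : (Matrix.of fun r (_ : Fin 3) => v r).mulVec ![0, 0, 1] = v := by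
      funext r
      simp [Matrix.mulVec, dotProduct, Fin.sum_univ_three]
    rw [h2, hp0] at h1
    rw [h1]
    simp [evalMatrix]
  have hgA : AnalyticAt ℂ (fun v => linearChange f A.1 (v, 0)) 0 :=
    AnalyticAt.fun_comp_of_eq (g := fun v => f (v, 0))
      (f := (A.1 : Matrix (Fin 3) (Fin 3) ℂ).mulVec) hg
      ((Matrix.mulVecLin (A.1 : Matrix (Fin 3) (Fin 3) ℂ)).toContinuousLinearMap.analyticAt _)
      (by simp)
  refine notMem_tangentConeZero hgA (m := d) (Eventually.of_forall fun w k hk => ?_) ?_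
  · simp only [linearChange, Matrix.mulVec_smul]
    exact hzero k hk _
  · obtain ⟨-, a, ha, -⟩ := hT A
    have h1 := ha.iteratedDeriv_ne_zero
    simp only [hline] at h1
    simpa only [linearChange, Matrix.mulVec_smul] using h1

lemma exists_discr_yAxis_notMem_tangentConeZero
    (hT : ∀ A : Locus h, HasSurfaceType (projGerm (linearChange f A.1)) d i m j M) (A : Locus h) :
    ∃ D : ℂ × ℂ → ℂ,
      IsFirstDiscr (fun q : (ℂ × ℂ) × ℂ => linearChange f A.1 (![q.1.1, q.1.2, q.2], 0)) D ∧
      ((0, 1) : ℂ × ℂ) ∉ tangentConeZero D := by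
  obtain ⟨hi, a, ha, hk, hc⟩ := hT A
  set L : (ℂ × ℂ) →L[ℂ] ℂ × ℂ × P :=
    (ContinuousLinearMap.id ℂ ℂ).prodMap (ContinuousLinearMap.inl ℂ ℂ P) with hL
  have hL0 : Tendsto L (𝓝 0) (𝓝 0) := L.continuous.tendsto' 0 0 (map_zero L)
  have haL := ha.comp_clm L
  have hm0 := hc.iteratedDeriv_ne_zero
  have ht : Tendsto (fun y : ℂ => ((0, y) : ℂ × ℂ)) (𝓝 0) (𝓝 0) :=
    (by fun_prop : Continuous fun y : ℂ => ((0, y) : ℂ × ℂ)).tendsto' 0 0 rfl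
  refine ⟨_, ⟨_, isWeierstrassPoly_iff.2 ⟨d, _, haL, rfl⟩, i, hi,
    fun k hk1 hk2 => hL0.eventually (hk k hk1 hk2), fun h0 => ?_, rfl⟩, ?_⟩
  · exact not_eventually_eq_zero_of_iteratedDeriv hm0 (ht.eventually h0)
  refine notMem_tangentConeZero (haL.analyticAt_genDiscr i) (m := m) ?_ ?_
  -- This change sends the `y`-axis to the direction `w` and fixes the other two axes; at `w = (0,
  -- 1)` it is the identity.
  · have hS : Continuous fun w : ℂ × ℂ => !![1, w.1, 0; 0, w.2, 0; 0, 0, 1] := by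
      refine continuous_matrix fun r s => ?_
      fin_cases r <;> fin_cases s <;> simp <;> fun_prop
    filter_upwards [A.eventually_exists_mul hS (x₀ := (0, 1)) (by
      ext r s; fin_cases r <;> fin_cases s <;> rfl)] with w ⟨A', hA'⟩ k hk
    obtain ⟨-, a', ha', -, hc'⟩ := hT A'
    set K : (ℂ × ℂ × P) →L[ℂ] ℂ × ℂ × P :=
      (ContinuousLinearMap.fst ℂ ℂ (ℂ × P) +
        w.1 • (ContinuousLinearMap.fst ℂ ℂ P).comp (ContinuousLinearMap.snd ℂ ℂ (ℂ × P))).prod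
      ((w.2 • (ContinuousLinearMap.fst ℂ ℂ P).comp (ContinuousLinearMap.snd ℂ ℂ (ℂ × P))).prod
        ((ContinuousLinearMap.snd ℂ ℂ P).comp (ContinuousLinearMap.snd ℂ ℂ (ℂ × P)))) with hK
    have h1 : projGerm (linearChange f A'.1) =
        fun q => projGerm (linearChange f A.1) (K q.1, q.2) := by
      funext q
      simp only [projGerm, linearChange, hA', ← Matrix.mulVec_mulVec]
      refine congrArg f (Prod.ext (congrArg (A.1 : Matrix (Fin 3) (Fin 3) ℂ).mulVec
        (_root_.funext fun r => ?_)) (by simp [hK]))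
      fin_cases r <;> simp [hK, Matrix.mulVec, dotProduct, Fin.sum_univ_three]
    rw [h1] at ha'
    -- By uniqueness, the discriminant in the new coordinates is the old one composed with `K`, so
    -- its order in `y` is the order of the old one along `w`; by constancy it is `m`.
    have h2 := ha'.eventuallyEq (ha.comp_clm K)
    have h3 : Tendsto (fun y : ℂ => ((0, y, 0) : ℂ × ℂ × P)) (𝓝 0) (𝓝 0) :=
      (by fun_prop : Continuous fun y : ℂ => ((0, y, 0) : ℂ × ℂ × P)).tendsto' 0 0 rfl
    refine Eq.trans (Filter.EventuallyEq.iteratedDeriv_eq k ?_) (hc'.iteratedDeriv_eq_zero hk)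
    filter_upwards [h3.eventually h2] with s hs
    rw [hs]
    congr 3
    simp [hK, hL, Prod.ext_iff, mul_comm]
  · simpa [hL] using hm0

/-- For fixed small `b` the sheared family is the original one in the coordinates `A * S b`, still
in `Locus h`; the slices thus share one type, which passes to the joint family. -/
lemma hasSurfaceType_shear [CompleteSpace P] (hf : AnalyticAt ℂ f 0)
    (hT : ∀ A : Locus h, HasSurfaceType (projGerm (linearChange f A.1)) d i m j M) (A : Locus h) :
    HasSurfaceType (fun q : (ℂ × ℂ × (ℂ × P)) × ℂ => linearChange f A.1
      (shear q.1.2.2.1 ![q.1.1, q.1.2.1, q.2], q.1.2.2.2)) d i m j M := by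
  refine HasSurfaceType.joint ?_ ?_
  · refine AnalyticAt.fun_comp_of_eq (g := f) (f := fun q : (ℂ × ℂ × (ℂ × P)) × ℂ =>
      ((A.1 : Matrix (Fin 3) (Fin 3) ℂ).mulVec (shear q.1.2.2.1 ![q.1.1, q.1.2.1, q.2]),
        q.1.2.2.2)) hf ?_ ?_
    · refine AnalyticAt.prod ?_ (by fun_prop)
      refine AnalyticAt.fun_comp_of_eq (g := (A.1 : Matrix (Fin 3) (Fin 3) ℂ).mulVec)
        (f := fun q : (ℂ × ℂ × (ℂ × P)) × ℂ => shear q.1.2.2.1 ![q.1.1, q.1.2.1, q.2])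
        ((Matrix.mulVecLin (A.1 : Matrix (Fin 3) (Fin 3) ℂ)).toContinuousLinearMap.analyticAt _)
        ?_ rfl
      rw [analyticAt_pi_iff]
      intro r
      fin_cases r <;> simp [shear] <;> fun_prop
    · refine Prod.ext (_root_.funext fun r => ?_) rfl
      simp [shear, Matrix.mulVec, dotProduct, Fin.sum_univ_three]
  · have hS : Continuous fun b : ℂ => !![1, 0, 0; 0, 1, b; 0, 0, 1] := by
      refine continuous_matrix fun r s => ?_
      fin_cases r <;> fin_cases s <;> simp <;> fun_prop
    filter_upwards [A.eventually_exists_mul hS (x₀ := 0) (by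
      ext r s; fin_cases r <;> fin_cases s <;> rfl)] with b ⟨A', hA'⟩
    have h1 : projGerm (linearChange f A'.1) = fun q : (ℂ × ℂ × P) × ℂ => linearChange f A.1
        (shear b ![q.1.1, q.1.2.1, q.2], q.1.2.2) := by
      funext q
      simp only [projGerm, linearChange, hA', ← Matrix.mulVec_mulVec]
      congr 3
      funext r
      fin_cases r <;> simp [shear, Matrix.mulVec, dotProduct, Fin.sum_univ_three]
    have h2 := hT A'
    rwa [h1] at h2

end Transversality

end

theorem mainTheorem7 (l : ℕ) (f : (Fin 3 → ℂ) × (Fin l → ℂ) → ℂ)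
    (hf : AnalyticAt ℂ f 0)
    (hf0 : ∀ᶠ t in 𝓝 (0 : Fin l → ℂ), f (0, t) = 0)
    (hZE : HoldsGenerically fun A => IsZariskiEquisingular (linearChange f A)) :
    HoldsGenerically fun A => IsNuTransverseZariskiEquisingular (linearChange f A) := by
  obtain ⟨U, ⟨S, rfl⟩, ⟨A₀, h₀, hS, hA₀⟩, hU⟩ := hZE
  obtain ⟨h, d, i, m, j, M, ⟨A₁⟩, hT⟩ := exists_locus_hasSurfaceType hf (h₀ := h₀) ⟨⟨A₀, hA₀⟩⟩
    fun A => by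
      obtain ⟨D, hD, hD'⟩ := hU A.1 ⟨h₀, hS, A.2⟩
      exact exists_hasSurfaceType hD hD'
  refine ⟨_, ⟨{h}, rfl⟩, ⟨A₁.1, h, rfl, A₁.2⟩, ?_⟩
  rintro A ⟨p, rfl, hA⟩
  have hJ := hasSurfaceType_shear hf hT ⟨A, hA⟩
  exact ⟨⟨zAxis_notMem_tangentConeZero hf hT ⟨A, hA⟩,
    exists_discr_yAxis_notMem_tangentConeZero hT ⟨A, hA⟩,
    -- Restricting the joint family in `(b, t)` to `t = 0` gives the equisingularity of the
    -- discriminants of `π_b` on `V_0`.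
    (hJ.comp_clm (ContinuousLinearMap.inl ℂ ℂ (Fin l → ℂ))).exists_isFirstDiscr⟩,
    hJ.exists_isFirstDiscr⟩
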